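/- Let $0<\alpha<2$, $\eta>0$ and let $m\ge 1$ be an integer. Let $S$ be the mixing density of the sub-Gaussian $\alpha$-stable distribution, i.e. a probability density on $\mathbb{R}$ of the totally skewed stable law with stability parameter $\alpha/2$, skewness $1$, scale $\gamma=\cos(\pi\alpha/4)^{2/\alpha}$ and location $0$: its characteristic function is $$\theta\mapsto\exp\!\left(-\gamma^{\alpha/2}|\theta|^{\alpha/2}\left[1-\mathrm{i}\tan\!\left(\tfrac{\pi\alpha}{4}\right)\operatorname{sign}\theta\right]\right).$$ For $y>0$ put $q'(y)=y^{-m/2}\exp\!\left(-\frac{\eta}{2y}\right)S(y)$. Then $q'$ and $y^{-1}q'$ are integrable on $(0,\infty)$ and $\int_0^\infty q'(y)\,dy>0$, so that the posterior expectation $$\mathrm{E}(y^{-1})=\frac{\int_0^{\infty}y^{-1}q'(y)\,dy}{\int_0^{\infty}q'(y)\,dy}$$ is well defined. For $\xi=1,2,\dots$ let $$a_\xi=\frac{\xi\alpha}{2}+\frac m2,\qquad b=\frac{\eta}{2},\qquad c_\xi=(-1)^{\xi+1}\,\frac{\Gamma(\xi\alpha/2+1)}{\pi\,\xi!}\,\sin\!\left(\frac{\xi\alpha\pi}{2}\right).$$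 Then $$\mathrm{E}(y^{-1})=\frac{\sum_{\xi=1}^{\infty}c_\xi\,\Gamma(a_\xi+1)/b^{a_\xi+1}}{\sum_{\xi=1}^{\infty}c_\xi\,\Gamma(a_\xi)/b^{a_\xi}}$$ if and only if both series converge (convergence being that of the partial sums). This holds in both senses that the equation can be given: (i) both series converge, the sum of the denominator series is not zero and $\mathrm{E}(y^{-1})$ is the quotient of the two sums; (ii) the quotient of the $n$-th partial sums of the two series tends to $\mathrm{E}(y^{-1})$ as $n\to\infty$. Each of (i) and (ii) holds if and only if both series converge. -/

import Mathlib

open MeasureTheory Filter Topology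

noncomputable section

namespace SGaS

/-- The characteristic function, at the frequency `θ`, of the univariate stable law with stability
`α`, skewness `β`, scale `γ` and location `δ`. -/
def stableCharFun (α β γ δ θ : ℝ) : ℂ :=
  if α ≠ 1 then
    Complex.exp
      (-((γ ^ α * |θ| ^ α : ℝ) : ℂ) *
          (1 - Complex.I * ((β * Real.tan (Real.pi * α / 2) * Real.sign θ : ℝ) : ℂ))
        + Complex.I * ((δ * θ : ℝ) : ℂ))
  else
    Complex.exp
      (-((γ * |θ| : ℝ) : ℂ) *
          (1 + Complex.I * ((β * (2 / Real.pi) * Real.sign θ * Real.log |θ| : ℝ) : ℂ))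
        + Complex.I * ((δ * θ : ℝ) : ℂ))

/-- `S` is a probability density function (with respect to Lebesgue measure on `ℝ`) of the
univariate stable law with parameters `α, β, γ, δ`: the law with density `S` is a probability
measure whose characteristic function is the stable one. -/
structure IsStablePDF (α β γ δ : ℝ) (S : ℝ → ℝ) : Prop where
  measurable : Measurable S
  nonneg : ∀ y, 0 ≤ S y
  isProbabilityMeasure :
    IsProbabilityMeasure (volume.withDensity fun y => ENNReal.ofReal (S y))
  charFun_eq : ∀ θ : ℝ,
    charFun (volume.withDensity fun y => ENNReal.ofReal (S y)) θ = stableCharFun α β γ δ θ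

/-- `S` is a mixing density of the sub-Gaussian `α`-stable distribution: a density of the
totally skewed stable law with stability `α / 2`, skewness `1`, scale `cos (π α / 4) ^ (2 / α)` and
location `0` (the law with Laplace transform `s ↦ exp (-s ^ (α / 2))`). -/
def IsMixingDensity (α : ℝ) (S : ℝ → ℝ) : Prop :=
  IsStablePDF (α / 2) 1 (Real.cos (Real.pi * α / 4) ^ (2 / α)) 0 S

/-- The unnormalised posterior density `q'` of the mixing parameter, used for `0 < y`. -/
def posterior (m : ℕ) (η : ℝ) (S : ℝ → ℝ) (y : ℝ) : ℝ :=
  y ^ (-((m : ℝ) / 2)) * Real.exp (-(η / (2 * y))) * S y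

/-- The posterior expectation `E(y⁻¹)` of the scale function `κ(y) = y⁻¹`. -/
def meanInv (m : ℕ) (η : ℝ) (S : ℝ → ℝ) : ℝ :=
  (∫ y in Set.Ioi (0 : ℝ), y⁻¹ * posterior m η S y) / ∫ y in Set.Ioi (0 : ℝ), posterior m η S y

/-- `a_ξ = ξ α / 2 + m / 2`. -/
def shapeA (α : ℝ) (m ξ : ℕ) : ℝ := (ξ : ℝ) * (α / 2) + (m : ℝ) / 2

/-- `c_ξ = (-1)^(ξ+1) Γ(ξ α / 2 + 1) / (π ξ!) sin (ξ (α / 2) π)`. -/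
def coeffC (α : ℝ) (ξ : ℕ) : ℝ :=
  (-1) ^ (ξ + 1) * (Real.Gamma ((ξ : ℝ) * (α / 2) + 1) / (Real.pi * (ξ.factorial : ℝ))) *
    Real.sin ((ξ : ℝ) * (α / 2) * Real.pi)

/-- The `ξ`-th term of the numerator series, with `b = η / 2`. -/
def numTerm (α : ℝ) (m : ℕ) (η : ℝ) (ξ : ℕ) : ℝ :=
  coeffC α ξ * (Real.Gamma (shapeA α m ξ + 1) / (η / 2) ^ (shapeA α m ξ + 1))

/-- The `ξ`-th term of the denominator series, with `b = η / 2`. -/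
def denTerm (α : ℝ) (m : ℕ) (η : ℝ) (ξ : ℕ) : ℝ :=
  coeffC α ξ * (Real.Gamma (shapeA α m ξ) / (η / 2) ^ shapeA α m ξ)

/-- The partial sum `r 1 + ⋯ + r n`. -/
def partialSum (r : ℕ → ℝ) (n : ℕ) : ℝ := ∑ ξ ∈ Finset.Icc 1 n, r ξ

/-- The series `∑_{ξ ≥ 1} r ξ` converges (possibly only conditionally) to `s`. -/
def SeriesSum (r : ℕ → ℝ) (s : ℝ) : Prop := Tendsto (partialSum r) atTop (𝓝 s)

/-- The series `∑_{ξ ≥ 1} r ξ` converges (possibly only conditionally). -/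
def SeriesConverges (r : ℕ → ℝ) : Prop := ∃ s, SeriesSum r s

end SGaS

end

/-! ### Gamma quotients and their growth -/

namespace SGaS

/-! The proof rests on a dichotomy, `summable_or_not_tendsto`: either both series converge
absolutely, or the denominator terms do not tend to zero and the quotients of partial sums have no
finite limit. In both cases each equivalence holds, its two sides being both true or both false;
conditional convergence never occurs.

Without the sine, consecutive terms have a ratio of order `n ^ (α - 1)`. For `α < 1` the ratio test
applies; for `α = 1` the ratio tends to `(2η) ^ (-1/2)`, so it applies when `η > 1/2`. For `α > 1`
each term outweighs all its predecessors, and wherever the sine is not small the quotient is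
comparable to the unbounded weight `a_n / b`. For `α = 1`, `η ≤ 1/2`, only odd terms survive; they
alternate without shrinking, and the quotient is unbounded along `4 j + 1`.

In the convergent case Fourier inversion writes `S` as a Laplace integral of `exp (-z t ^ (α / 2))`
on the imaginary axis. Expanding that exponential gives `S y = ∑ c_k y ^ (-(k α / 2 + 1))` for
almost every `y > 0` (`IsMixingDensity.ae_hasSum`). Termwise integration against `y ^ (-m/2) exp (-η
/ (2 y))` yields inverse Gamma integrals, i.e. the denominator series; replacing `m` by `m + 2`
yields the numerator. -/

theorem gamma_add_le {β x : ℝ} (hβ0 : 0 < β) (hβ1 : β < 1) (hx : 0 < x) :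
    Real.Gamma (x + β) ≤ x ^ β * Real.Gamma x := by
  have h := Real.Gamma_mul_add_mul_le_rpow_Gamma_mul_rpow_Gamma (s := x) (t := x + 1)
    (a := 1 - β) (b := β) hx (by linarith) (by linarith) hβ0 (by ring)
  have hG := Real.Gamma_pos_of_pos hx
  have e : (1 - β) * x + β * (x + 1) = x + β := by ring
  rw [e, Real.Gamma_add_one hx.ne', Real.mul_rpow hx.le hG.le] at h
  calc _ ≤ _ := h
    _ = x ^ β * (Real.Gamma x ^ (1 - β) * Real.Gamma x ^ β) := by ring
    _ = _ := by rw [← Real.rpow_add hG]; simp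

/-- The log-convexity bound used with exponent `1 - β` at `x + β` reaches `Γ(x + 1) = x Γ(x)`; it is
the lower half of the squeeze for `Γ(x + β) / Γ(x)`. -/
theorem mul_gamma_le_gamma_add {β x : ℝ} (hβ0 : 0 < β) (hβ1 : β < 1) (hx : 0 < x) :
    x * (x + β) ^ (β - 1) * Real.Gamma x ≤ Real.Gamma (x + β) := by
  have h := gamma_add_le (β := 1 - β) (x := x + β) (by linarith) (by linarith) (by linarith)
  have e : x + β + (1 - β) = x + 1 := by ring
  rw [e, Real.Gamma_add_one hx.ne'] at h
  have hp : 0 < (x + β) ^ (1 - β) := Real.rpow_pos_of_pos (by linarith) _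
  have e2 : (x + β) ^ (β - 1) = ((x + β) ^ (1 - β))⁻¹ := by
    rw [← Real.rpow_neg (by linarith)]; ring_nf
  rw [e2, mul_right_comm, ← div_eq_mul_inv, div_le_iff₀ hp]
  linarith

/-- The quotient of the Gamma function at points with distance `β` behaves like `x ^ β`. -/
theorem tendsto_gamma_add_div {β c : ℝ} (hβ0 : 0 < β) (hβ1 : β < 1) (hc : 0 < c) :
    Tendsto (fun n : ℕ => Real.Gamma ((n : ℝ) * β + c + β) /
      (Real.Gamma ((n : ℝ) * β + c) * (n : ℝ) ^ β)) atTop (𝓝 (β ^ β)) := by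
  have hlin : ∀ d : ℝ, Tendsto (fun n : ℕ => ((n : ℝ) * β + d) / n) atTop (𝓝 β) := by
    intro d
    have : Tendsto (fun n : ℕ => β + d / (n : ℝ)) atTop (𝓝 (β + 0)) :=
      tendsto_const_nhds.add (tendsto_const_div_atTop_nhds_zero_nat d)
    rw [add_zero] at this
    refine this.congr' ?_
    filter_upwards [eventually_gt_atTop 0] with n hn
    have : (n : ℝ) ≠ 0 := by positivity
    field_simp
  have hup : Tendsto (fun n : ℕ => (((n : ℝ) * β + c) / n) ^ β) atTop (𝓝 (β ^ β)) :=
    (hlin c).rpow_const (Or.inl hβ0.ne')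
  have hlo : Tendsto (fun n : ℕ => (((n : ℝ) * β + c) / n) *
      (((n : ℝ) * β + (c + β)) / n) ^ (β - 1)) atTop (𝓝 (β ^ β)) := by
    have := (hlin c).mul ((hlin (c + β)).rpow_const (p := β - 1) (Or.inl hβ0.ne'))
    convert this using 2
    rw [Real.rpow_sub_one hβ0.ne']; field_simp
  refine tendsto_of_tendsto_of_tendsto_of_le_of_le' hlo hup ?_ ?_
  · filter_upwards [eventually_gt_atTop 0] with n hn
    have hn' : (0 : ℝ) < n := by positivity
    have hx : 0 < (n : ℝ) * β + c := by positivity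
    have hG := Real.Gamma_pos_of_pos hx
    have h := mul_gamma_le_gamma_add hβ0 hβ1 hx
    rw [le_div_iff₀ (by positivity), Real.div_rpow (by positivity) hn'.le,
      Real.rpow_sub_one hn'.ne', ← add_assoc]
    refine le_trans (le_of_eq ?_) h
    have : (n : ℝ) ^ β ≠ 0 := by positivity
    field_simp
  · filter_upwards [eventually_gt_atTop 0] with n hn
    have hn' : (0 : ℝ) < n := by positivity
    have hx : 0 < (n : ℝ) * β + c := by positivity
    have hG := Real.Gamma_pos_of_pos hx
    have h := gamma_add_le hβ0 hβ1 hx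
    rw [div_le_iff₀ (by positivity), Real.div_rpow (by positivity) hn'.le]
    refine h.trans (le_of_eq ?_)
    have : (n : ℝ) ^ β ≠ 0 := by positivity
    field_simp

theorem tendsto_natCast_rpow_mul_of_lt {p : ℝ} (hp : p < 1) :
    Tendsto (fun n : ℕ => (n : ℝ) ^ p / ((n : ℝ) + 1)) atTop (𝓝 0) := by
  have h := (tendsto_rpow_neg_atTop (y := 1 - p) (by linarith)).comp tendsto_natCast_atTop_atTop
  refine squeeze_zero' (Eventually.of_forall fun n => by positivity) ?_ h
  filter_upwards [eventually_gt_atTop 0] with n hn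
  have hn' : (0 : ℝ) < n := by positivity
  simp only [Function.comp]
  rw [neg_sub, Real.rpow_sub_one hn'.ne']
  gcongr
  linarith

/-- The ratio of consecutive terms is of order `n ^ (β - 1)`, so it tends to zero whatever `r` is.
This controls the expansion of the density at every `y > 0`. -/
theorem summable_gamma_div_factorial {β r : ℝ} (hβ0 : 0 < β) (hβ1 : β < 1) (hr : 0 < r) :
    Summable (fun n : ℕ => Real.Gamma ((n : ℝ) * β + 1) / n.factorial * r ^ ((n : ℝ) * β)) := by
  have hpos : ∀ n : ℕ, 0 < Real.Gamma ((n : ℝ) * β + 1) / n.factorial * r ^ ((n : ℝ) * β) := by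
    intro n
    have : 0 < Real.Gamma ((n : ℝ) * β + 1) := Real.Gamma_pos_of_pos (by positivity)
    positivity
  refine summable_of_ratio_test_tendsto_lt_one (l := 0) one_pos
    (Eventually.of_forall fun n => (hpos n).ne') ?_
  have h := ((tendsto_gamma_add_div hβ0 hβ1 one_pos).mul
    (tendsto_natCast_rpow_mul_of_lt hβ1)).mul_const (r ^ β)
  rw [mul_zero, zero_mul] at h
  refine h.congr' ?_
  filter_upwards [eventually_gt_atTop 0] with n hn
  rw [Real.norm_of_nonneg (hpos _).le, Real.norm_of_nonneg (hpos _).le]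
  have hn' : (0 : ℝ) < n := by positivity
  have hG : 0 < Real.Gamma ((n : ℝ) * β + 1) := Real.Gamma_pos_of_pos (by positivity)
  have e : ((n + 1 : ℕ) : ℝ) * β + 1 = (n : ℝ) * β + 1 + β := by push_cast; ring
  have e2 : r ^ (((n + 1 : ℕ) : ℝ) * β) = r ^ ((n : ℝ) * β) * r ^ β := by
    rw [← Real.rpow_add hr]; push_cast; ring_nf
  rw [e, e2, Nat.factorial_succ]
  push_cast
  have : (n : ℝ) ^ β ≠ 0 := by positivity
  have : r ^ ((n : ℝ) * β) ≠ 0 := by positivity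
  field_simp

/-! ### Size of the series terms -/

/-- The absolute value of the `ξ`-th term of the denominator series, without the sine factor. -/
noncomputable def termSize (α : ℝ) (m : ℕ) (η : ℝ) (ξ : ℕ) : ℝ :=
  Real.Gamma ((ξ : ℝ) * (α / 2) + 1) / (Real.pi * (ξ.factorial : ℝ)) *
    (Real.Gamma (shapeA α m ξ) / (η / 2) ^ shapeA α m ξ)

theorem shapeA_pos {α : ℝ} {m : ℕ} (hα0 : 0 < α) (hm : 1 ≤ m) (ξ : ℕ) : 0 < shapeA α m ξ := by
  have : (1 : ℝ) ≤ m := by exact_mod_cast hm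
  unfold shapeA
  positivity

theorem shapeA_succ (α : ℝ) (m ξ : ℕ) : shapeA α m (ξ + 1) = shapeA α m ξ + α / 2 := by
  unfold shapeA; push_cast; ring

theorem shapeA_add_two (α : ℝ) (m ξ : ℕ) : shapeA α (m + 2) ξ = shapeA α m ξ + 1 := by
  unfold shapeA; push_cast; ring

theorem tendsto_shapeA {α : ℝ} (hα0 : 0 < α) (m : ℕ) : Tendsto (shapeA α m) atTop atTop :=
  tendsto_atTop_add_const_right _ _
    (tendsto_natCast_atTop_atTop.atTop_mul_const (by positivity))

theorem termSize_pos {α η : ℝ} {m : ℕ} (hα0 : 0 < α) (hη : 0 < η) (hm : 1 ≤ m) (ξ : ℕ) :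
    0 < termSize α m η ξ := by
  have h1 : 0 < Real.Gamma ((ξ : ℝ) * (α / 2) + 1) := Real.Gamma_pos_of_pos (by positivity)
  have h2 := Real.Gamma_pos_of_pos (shapeA_pos hα0 hm ξ)
  have := Real.pi_pos
  unfold termSize
  positivity

theorem denTerm_eq (α : ℝ) (m : ℕ) (η : ℝ) (ξ : ℕ) :
    denTerm α m η ξ =
      (-1) ^ (ξ + 1) * Real.sin ((ξ : ℝ) * (α / 2) * Real.pi) * termSize α m η ξ := by
  unfold denTerm coeffC termSize; ring

theorem abs_denTerm {α η : ℝ} {m : ℕ} (hα0 : 0 < α) (hη : 0 < η) (hm : 1 ≤ m) (ξ : ℕ) :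
    |denTerm α m η ξ| = |Real.sin ((ξ : ℝ) * (α / 2) * Real.pi)| * termSize α m η ξ := by
  rw [denTerm_eq, abs_mul, abs_mul, abs_of_pos (termSize_pos hα0 hη hm ξ)]
  simp

theorem abs_denTerm_le {α η : ℝ} {m : ℕ} (hα0 : 0 < α) (hη : 0 < η) (hm : 1 ≤ m) (ξ : ℕ) :
    |denTerm α m η ξ| ≤ termSize α m η ξ := by
  rw [abs_denTerm hα0 hη hm]
  exact mul_le_of_le_one_left (termSize_pos hα0 hη hm ξ).le (Real.abs_sin_le_one _)

/-- The extra factor `y⁻¹` amounts to raising `m` by two, so convergence results for the denominator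
also serve the numerator. -/
theorem numTerm_eq_denTerm_add_two (α : ℝ) (m : ℕ) (η : ℝ) :
    numTerm α m η = denTerm α (m + 2) η := by
  funext ξ
  unfold numTerm denTerm
  rw [shapeA_add_two]

/-- The weights `a_ξ / b` increase to infinity; this is what makes the quotients of partial sums
unbounded in the divergent case. -/
theorem numTerm_eq_mul_denTerm {α η : ℝ} {m : ℕ} (hα0 : 0 < α) (hη : 0 < η) (hm : 1 ≤ m) (ξ : ℕ) :
    numTerm α m η ξ = shapeA α m ξ / (η / 2) * denTerm α m η ξ := by
  have hb : 0 < η / 2 := by positivity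
  unfold numTerm denTerm
  rw [Real.Gamma_add_one (shapeA_pos hα0 hm ξ).ne', Real.rpow_add_one hb.ne']
  have : (η / 2) ^ shapeA α m ξ ≠ 0 := by positivity
  field_simp

/-- The factors are grouped so that both Gamma quotients converge and `n ^ α / (n + 1)` alone
decides between the regimes of `α`. -/
theorem termSize_ratio {α η : ℝ} {m : ℕ} (hα0 : 0 < α) (hη : 0 < η) (hm : 1 ≤ m)
    {n : ℕ} (hn : 0 < n) :
    termSize α m η (n + 1) / termSize α m η n =
      (Real.Gamma ((n : ℝ) * (α / 2) + 1 + α / 2) /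
        (Real.Gamma ((n : ℝ) * (α / 2) + 1) * (n : ℝ) ^ (α / 2))) *
      (Real.Gamma ((n : ℝ) * (α / 2) + (m : ℝ) / 2 + α / 2) /
        (Real.Gamma ((n : ℝ) * (α / 2) + (m : ℝ) / 2) * (n : ℝ) ^ (α / 2))) *
      ((n : ℝ) ^ α / ((n : ℝ) + 1)) * ((η / 2) ^ (α / 2))⁻¹ := by
  have hb : 0 < η / 2 := by positivity
  have hn' : (0 : ℝ) < n := by positivity
  have h1 : 0 < Real.Gamma ((n : ℝ) * (α / 2) + 1) := Real.Gamma_pos_of_pos (by positivity)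
  have h2 : 0 < Real.Gamma ((n : ℝ) * (α / 2) + (m : ℝ) / 2) :=
    Real.Gamma_pos_of_pos (shapeA_pos hα0 hm n)
  have hpi := Real.pi_pos
  have e1 : ((n + 1 : ℕ) : ℝ) * (α / 2) + 1 = (n : ℝ) * (α / 2) + 1 + α / 2 := by
    push_cast; ring
  have e3 : (n : ℝ) ^ α = (n : ℝ) ^ (α / 2) * (n : ℝ) ^ (α / 2) := by
    rw [← Real.rpow_add hn']; ring_nf
  unfold termSize
  rw [shapeA_succ, Real.rpow_add hb, e1, e3, Nat.factorial_succ]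
  unfold shapeA
  push_cast
  have : (n : ℝ) ^ (α / 2) ≠ 0 := by positivity
  have : (η / 2) ^ (α / 2) ≠ 0 := by positivity
  have : (η / 2) ^ ((n : ℝ) * (α / 2) + (m : ℝ) / 2) ≠ 0 := by positivity
  field_simp

theorem tendsto_gamma_factors {α : ℝ} {m : ℕ} (hα0 : 0 < α) (hα2 : α < 2) (hm : 1 ≤ m) :
    Tendsto (fun n : ℕ => (Real.Gamma ((n : ℝ) * (α / 2) + 1 + α / 2) /
        (Real.Gamma ((n : ℝ) * (α / 2) + 1) * (n : ℝ) ^ (α / 2))) *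
      (Real.Gamma ((n : ℝ) * (α / 2) + (m : ℝ) / 2 + α / 2) /
        (Real.Gamma ((n : ℝ) * (α / 2) + (m : ℝ) / 2) * (n : ℝ) ^ (α / 2)))) atTop
      (𝓝 ((α / 2) ^ (α / 2) * (α / 2) ^ (α / 2))) := by
  have : (1 : ℝ) ≤ m := by exact_mod_cast hm
  exact (tendsto_gamma_add_div (by positivity) (by linarith) one_pos).mul
    (tendsto_gamma_add_div (by positivity) (by linarith) (by positivity))

theorem summable_termSize_of_tendsto {α η : ℝ} {m : ℕ} (hα0 : 0 < α) (hα2 : α < 2) (hη : 0 < η)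
    (hm : 1 ≤ m) {l : ℝ}
    (hl : Tendsto (fun n : ℕ => (n : ℝ) ^ α / ((n : ℝ) + 1)) atTop (𝓝 l))
    (hl1 : (α / 2) ^ (α / 2) * (α / 2) ^ (α / 2) * l * ((η / 2) ^ (α / 2))⁻¹ < 1) :
    Summable (termSize α m η) := by
  refine summable_of_ratio_test_tendsto_lt_one hl1
    (Eventually.of_forall fun n => (termSize_pos hα0 hη hm n).ne') ?_
  refine (((tendsto_gamma_factors hα0 hα2 hm).mul hl).mul_const _).congr' ?_
  filter_upwards [eventually_gt_atTop 0] with n hn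
  rw [Real.norm_of_nonneg (termSize_pos hα0 hη hm _).le,
    Real.norm_of_nonneg (termSize_pos hα0 hη hm _).le, termSize_ratio hα0 hη hm hn]

theorem summable_termSize_of_lt_one {α η : ℝ} {m : ℕ} (hα0 : 0 < α) (hα1 : α < 1) (hη : 0 < η)
    (hm : 1 ≤ m) : Summable (termSize α m η) :=
  summable_termSize_of_tendsto hα0 (by linarith) hη hm (tendsto_natCast_rpow_mul_of_lt hα1)
    (by simp)

/-- The limiting ratio is `(1/2) / (η/2) ^ (1/2) = (2η) ^ (-1/2)`, which is below one exactly when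
`η > 1/2`. -/
theorem summable_termSize_one {η : ℝ} {m : ℕ} (hη : 1 / 2 < η) (hm : 1 ≤ m) :
    Summable (termSize 1 m η) := by
  refine summable_termSize_of_tendsto one_pos (by norm_num) (by linarith) hm (l := 1) ?_ ?_
  · simpa using tendsto_natCast_div_add_atTop (1 : ℝ)
  · have h : (1 / 2 : ℝ) ^ (1 / 2 : ℝ) < (η / 2) ^ (1 / 2 : ℝ) * ((1 / 2 : ℝ) ^ (1 / 2 : ℝ))⁻¹ := by
      rw [← div_eq_mul_inv, ← Real.div_rpow (by linarith) (by norm_num)]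
      exact Real.rpow_lt_rpow (by norm_num) (by linarith) (by norm_num)
    have hp : 0 < (1 / 2 : ℝ) ^ (1 / 2 : ℝ) := by positivity
    have hq : 0 < (η / 2) ^ (1 / 2 : ℝ) := Real.rpow_pos_of_pos (by linarith) _
    rw [mul_one, ← div_eq_mul_inv, div_lt_one hq]
    rwa [← div_eq_mul_inv, lt_div_iff₀ hp] at h

theorem tendsto_termSize_ratio_atTop {α η : ℝ} {m : ℕ} (hα1 : 1 < α) (hα2 : α < 2) (hη : 0 < η)
    (hm : 1 ≤ m) :
    Tendsto (fun n => termSize α m η (n + 1) / termSize α m η n) atTop atTop := by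
  have hα0 : 0 < α := by linarith
  have h1 : Tendsto (fun n : ℕ => (n : ℝ) ^ α / ((n : ℝ) + 1)) atTop atTop := by
    have h := ((tendsto_rpow_atTop (y := α - 1) (by linarith)).comp
      tendsto_natCast_atTop_atTop).atTop_div_const (r := 2) two_pos
    refine tendsto_atTop_mono' _ ?_ h
    filter_upwards [eventually_gt_atTop 0] with n hn
    have hn' : (1 : ℝ) ≤ n := by exact_mod_cast hn
    have h0 : (n : ℝ) ≠ 0 := by positivity
    simp only [Function.comp]
    rw [Real.rpow_sub_one h0, div_div]
    gcongr
    linarith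
  have h2 := ((tendsto_gamma_factors hα0 hα2 hm).pos_mul_atTop (by positivity) h1).atTop_mul_const
    (r := ((η / 2) ^ (α / 2))⁻¹) (by positivity)
  refine h2.congr' ?_
  filter_upwards [eventually_gt_atTop 0] with n hn
  rw [termSize_ratio hα0 hη hm hn]

/-! ### Divergence criteria for quotients of partial sums -/

theorem partialSum_succ (r : ℕ → ℝ) (n : ℕ) : partialSum r (n + 1) = partialSum r n + r (n + 1) := by
  unfold partialSum
  rw [Finset.sum_Icc_succ_top (by omega)]

theorem abs_partialSum_le {r t : ℕ → ℝ} (h : ∀ n, |r n| ≤ t n) (n : ℕ) :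
    |partialSum r n| ≤ partialSum t n :=
  (Finset.abs_sum_le_sum_abs _ _).trans (Finset.sum_le_sum fun i _ => h i)

/-- If consecutive quotients tend to infinity, then each term dominates the sum of all its
predecessors. -/
theorem tendsto_partialSum_div_succ {t : ℕ → ℝ} (ht : ∀ n, 0 < t n)
    (hr : Tendsto (fun n => t (n + 1) / t n) atTop atTop) :
    Tendsto (fun n => partialSum t n / t (n + 1)) atTop (𝓝 0) := by
  set R : ℕ → ℝ := fun n => partialSum t n / t (n + 1) with hR
  have hq : Tendsto (fun n => t (n + 1) / t (n + 2)) atTop (𝓝 0) := by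
    have h := (hr.comp (tendsto_add_atTop_nat 1)).inv_tendsto_atTop
    refine h.congr fun n => ?_
    simp [inv_div]
  -- The recursion first keeps `R` bounded, once the factor is at most `1/2`; a bounded quantity
  -- times a factor tending to zero then tends to zero.
  have hstep : ∀ n, R (n + 1) = (R n + 1) * (t (n + 1) / t (n + 2)) := by
    intro n
    have h1 := (ht (n + 1)).ne'
    have h2 := (ht (n + 2)).ne'
    simp only [hR, partialSum_succ]
    field_simp
  have hR0 : ∀ n, 0 ≤ R n := fun n =>
    div_nonneg (Finset.sum_nonneg fun i _ => (ht i).le) (ht _).le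
  obtain ⟨n₀, hn₀⟩ := eventually_atTop.1 (hq.eventually_le_const (u := 1 / 2) (by norm_num))
  have hB : ∀ n, n₀ ≤ n → R n ≤ max (R n₀) 1 := by
    intro n hn
    induction n, hn using Nat.le_induction with
    | base => exact le_max_left _ _
    | succ n hn ih =>
      rw [hstep]
      have h1 : (R n + 1) * (t (n + 1) / t (n + 2)) ≤ (R n + 1) * (1 / 2) :=
        mul_le_mul_of_nonneg_left (hn₀ n hn) (by linarith [hR0 n])
      have h2 : (1 : ℝ) ≤ max (R n₀) 1 := le_max_right _ _
      linarith
  rw [← tendsto_add_atTop_iff_nat 1]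
  have hz : Tendsto (fun n => (max (R n₀) 1 + 1) * (t (n + 1) / t (n + 2))) atTop (𝓝 0) := by
    simpa using hq.const_mul (max (R n₀) 1 + 1)
  refine squeeze_zero' (Eventually.of_forall fun n => hR0 _) ?_ hz
  filter_upwards [eventually_ge_atTop n₀] with n hn
  rw [hstep]
  have := div_pos (ht (n + 1)) (ht (n + 2))
  gcongr
  exact hB n hn

theorem not_tendsto_zero_of_dominant {t d : ℕ → ℝ} {s : ℝ} (ht : ∀ n, 0 < t n)
    (hr : Tendsto (fun n => t (n + 1) / t n) atTop atTop) (hs : 0 < s)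
    (hd : ∃ᶠ n in atTop, s * t n ≤ |d n|) : ¬ Tendsto d atTop (𝓝 0) := by
  intro h
  obtain ⟨n₀, hn₀⟩ := eventually_atTop.1 (hr.eventually_ge_atTop 1)
  have hB : ∀ n, n₀ ≤ n → t n₀ ≤ t n := by
    intro n hn
    induction n, hn using Nat.le_induction with
    | base => exact le_rfl
    | succ n hn ih =>
      have := hn₀ n hn
      rw [one_le_div (ht n)] at this
      exact ih.trans this
  have h2 : ∀ᶠ n in atTop, |d n| < s * t n₀ := by
    have := h.abs
    rw [abs_zero] at this
    exact this.eventually_lt_const (mul_pos hs (ht n₀))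
  obtain ⟨n, h3, h4, h5⟩ := (hd.and_eventually (h2.and (eventually_ge_atTop n₀))).exists
  have := mul_le_mul_of_nonneg_left (hB n h5) hs.le
  linarith

/-- At indices where `|d n|` is comparable to `t n`, the last term dominates both partial sums, so
their quotient is comparable to `a n`. -/
theorem not_tendsto_ratio_of_dominant {t d a : ℕ → ℝ} {s : ℝ} (ht : ∀ n, 0 < t n)
    (hr : Tendsto (fun n => t (n + 1) / t n) atTop atTop) (hs : 0 < s)
    (hdt : ∀ n, |d n| ≤ t n) (hd : ∃ᶠ n in atTop, s * t n ≤ |d n|)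
    (ha0 : ∀ n, 0 < a n) (ha : Monotone a) (ha' : Tendsto a atTop atTop) (E : ℝ) :
    ¬ Tendsto (fun n => partialSum (fun k => a k * d k) n / partialSum d n) atTop (𝓝 E) := by
  intro h
  have h1 : ∀ᶠ n in atTop,
      |partialSum (fun k => a k * d k) n / partialSum d n| < |E| + 1 :=
    h.abs.eventually_lt_const (by linarith)
  have h2 : ∀ᶠ n in atTop, partialSum t (n - 1) / t n ≤ s / 2 := by
    have h0 : Tendsto (fun n => partialSum t (n - 1) / t n) atTop (𝓝 0) :=
      (tendsto_add_atTop_iff_nat 1).1 (tendsto_partialSum_div_succ ht hr)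
    exact h0.eventually_le_const (by positivity)
  -- The numerator will be at least `a * (s / 2) * t` and the denominator at most `2 * t`, hence a
  -- quotient of at least `a * s / 4`.
  have h3 := ha'.eventually_ge_atTop ((|E| + 1) * (4 / s))
  obtain ⟨n, hn, hn1, hn2, hn3, hn4⟩ :=
    (hd.and_eventually (h1.and (h2.and (h3.and (eventually_gt_atTop 0))))).exists
  obtain ⟨k, rfl⟩ : ∃ k, n = k + 1 := ⟨n - 1, by omega⟩
  have htk := ht (k + 1)
  simp only [Nat.add_sub_cancel] at hn2
  rw [div_le_iff₀ htk] at hn2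
  have hD := abs_partialSum_le hdt k
  have hN : |partialSum (fun k => a k * d k) k| ≤ a (k + 1) * partialSum t k := by
    unfold partialSum
    rw [Finset.mul_sum]
    refine (Finset.abs_sum_le_sum_abs _ _).trans (Finset.sum_le_sum fun i hi => ?_)
    rw [abs_mul, abs_of_pos (ha0 i)]
    have : a i ≤ a (k + 1) := ha (by have := (Finset.mem_Icc.1 hi).2; omega)
    exact mul_le_mul this (hdt i) (abs_nonneg _) (ha0 _).le
  rw [partialSum_succ, partialSum_succ, abs_div] at hn1
  have hdk := hdt (k + 1)
  have hak := ha0 (k + 1)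
  have hDlow : s / 2 * t (k + 1) ≤ |partialSum d k + d (k + 1)| := by
    have := abs_sub_abs_le_abs_sub (d (k + 1)) (-partialSum d k)
    rw [abs_neg, sub_neg_eq_add, add_comm (d (k + 1))] at this
    linarith
  -- Since `s * t ≤ |d| ≤ t` at this index, the earlier terms contribute at most `t / 2`.
  have hDup : |partialSum d k + d (k + 1)| ≤ 2 * t (k + 1) := by
    have := abs_add_le (partialSum d k) (d (k + 1))
    nlinarith
  have hNlow : a (k + 1) * (s / 2 * t (k + 1)) ≤
      |partialSum (fun k => a k * d k) k + a (k + 1) * d (k + 1)| := by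
    have h := abs_sub_abs_le_abs_sub (a (k + 1) * d (k + 1))
      (-partialSum (fun k => a k * d k) k)
    rw [abs_neg, sub_neg_eq_add, add_comm (a (k + 1) * d (k + 1)), abs_mul, abs_of_pos hak] at h
    have h4 := mul_le_mul_of_nonneg_left hn hak.le
    have h5 := mul_le_mul_of_nonneg_left hn2 hak.le
    linarith
  have hDpos : 0 < |partialSum d k + d (k + 1)| := lt_of_lt_of_le (by positivity) hDlow
  rw [div_lt_iff₀ hDpos] at hn1
  have hE : 0 ≤ |E| + 1 := by positivity
  have h6 := mul_le_mul_of_nonneg_left hDup hE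
  have h7 : (|E| + 1) * (2 * t (k + 1)) ≤ a (k + 1) * (s / 2 * t (k + 1)) := by
    have := mul_le_mul_of_nonneg_right hn3 (by positivity : 0 ≤ s / 2 * t (k + 1))
    refine le_trans (le_of_eq ?_) this
    field_simp
    ring
  linarith

/-- Writing `x = (k + 1) x - k x` bounds `|sin x|` by the sum of two consecutive values, so one of
them is at least half of it; no equidistribution is needed. -/
theorem frequently_le_abs_sin (x : ℝ) :
    ∃ᶠ n : ℕ in atTop, |Real.sin x| / 2 ≤ |Real.sin ((n : ℝ) * x)| := by
  rw [frequently_atTop]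
  intro k
  by_contra! h
  have h1 := h k le_rfl
  have h2 := h (k + 1) (by omega)
  have e : Real.sin x = Real.sin (((k + 1 : ℕ) : ℝ) * x) * Real.cos ((k : ℝ) * x) -
      Real.cos (((k + 1 : ℕ) : ℝ) * x) * Real.sin ((k : ℝ) * x) := by
    rw [← Real.sin_sub]; congr 1; push_cast; ring
  have h3 : |Real.sin x| ≤ |Real.sin (((k + 1 : ℕ) : ℝ) * x)| + |Real.sin ((k : ℝ) * x)| := by
    rw [e]
    refine (abs_sub _ _).trans (add_le_add ?_ ?_) <;> rw [abs_mul]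
    · exact mul_le_of_le_one_right (abs_nonneg _) (Real.abs_cos_le_one _)
    · exact mul_le_of_le_one_left (abs_nonneg _) (Real.abs_cos_le_one _)
  linarith

/-- Growth along `4 j + 1` of an alternating series over the odd numbers whose terms do not decrease
in absolute value, and of the series weighted by `c + k / 2`. -/
theorem alternating_partialSum_bounds {d ρ : ℕ → ℝ} (heven : ∀ k, d (2 * k) = 0)
    (hstep : ∀ k, d (k + 2) = -ρ k * d k) (hρ : ∀ k, 1 ≤ ρ k) (hd1 : 0 < d 1) {c : ℝ} (j : ℕ) :
    d 1 ≤ partialSum d (4 * j + 1) ∧ partialSum d (4 * j + 1) ≤ d (4 * j + 1) ∧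
      (c + j) * partialSum d (4 * j + 1) ≤
        partialSum (fun k => (c + (k : ℝ) / 2) * d k) (4 * j + 1) := by
  induction j with
  | zero =>
    refine ⟨?_, ?_, ?_⟩ <;> simp [partialSum]
    nlinarith
  | succ j ih =>
    obtain ⟨h1, h2, h3⟩ := ih
    have e2 : d (4 * j + 2) = 0 := by have := heven (2 * j + 1); convert this using 2; ring
    have e4 : d (4 * j + 4) = 0 := by have := heven (2 * j + 2); convert this using 2; ring
    have e3 : d (4 * j + 3) = -ρ (4 * j + 1) * d (4 * j + 1) := hstep _
    have e5 : d (4 * j + 5) = -ρ (4 * j + 3) * d (4 * j + 3) := hstep _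
    have r1 := hρ (4 * j + 1)
    have r3 := hρ (4 * j + 3)
    have i3 : d (4 * j + 3) ≤ -d (4 * j + 1) := by rw [e3]; nlinarith
    have i5 : -d (4 * j + 3) ≤ d (4 * j + 5) := by rw [e5]; nlinarith
    have hj : 4 * (j + 1) + 1 = 4 * j + 1 + 1 + 1 + 1 + 1 := by ring
    have hD : partialSum d (4 * (j + 1) + 1) =
        partialSum d (4 * j + 1) + d (4 * j + 3) + d (4 * j + 5) := by
      rw [hj]
      simp only [partialSum_succ]
      rw [show 4 * j + 1 + 1 = 4 * j + 2 from rfl, e2,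
        show 4 * j + 2 + 1 + 1 = 4 * j + 4 from rfl, e4]
      ring_nf
    have hN : partialSum (fun k => (c + (k : ℝ) / 2) * d k) (4 * (j + 1) + 1) =
        partialSum (fun k => (c + (k : ℝ) / 2) * d k) (4 * j + 1) +
          (c + 2 * j + 3 / 2) * d (4 * j + 3) + (c + 2 * j + 5 / 2) * d (4 * j + 5) := by
      rw [hj]
      simp only [partialSum_succ]
      rw [show 4 * j + 1 + 1 = 4 * j + 2 from rfl, e2,
        show 4 * j + 2 + 1 + 1 = 4 * j + 4 from rfl, e4]
      push_cast
      ring_nf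
    rw [hD, hN, show d (4 * (j + 1) + 1) = d (4 * j + 5) from rfl]
    refine ⟨by linarith, by linarith, ?_⟩
    push_cast
    -- With `P` the previous partial sum, the new inequality has slack at least `(j + 1/2) (d (4j+3)
    -- + d (4j+5)) + (d (4j+5) - P)`, and `P ≤ d (4j+1) ≤ d (4j+5)`.
    have : 0 ≤ (j + 1 / 2 : ℝ) * (d (4 * j + 3) + d (4 * j + 5)) :=
      mul_nonneg (by positivity) (by linarith)
    nlinarith

theorem not_tendsto_of_alternating {d ρ : ℕ → ℝ} (heven : ∀ k, d (2 * k) = 0)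
    (hstep : ∀ k, d (k + 2) = -ρ k * d k) (hρ : ∀ k, 1 ≤ ρ k) (hd1 : 0 < d 1) (c : ℝ) :
    ¬ Tendsto d atTop (𝓝 0) ∧ ∀ E : ℝ, ¬ Tendsto (fun n =>
      partialSum (fun k => (c + (k : ℝ) / 2) * d k) n / partialSum d n) atTop (𝓝 E) := by
  have hB := fun j => alternating_partialSum_bounds heven hstep hρ hd1 (c := c) j
  have hsub : Tendsto (fun j : ℕ => 4 * j + 1) atTop atTop :=
    tendsto_atTop_mono (fun j => by simp only [id]; omega) tendsto_id
  constructor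
  · intro h
    have h1 := h.comp hsub
    have := ge_of_tendsto' h1 (fun j => (hB j).1.trans (hB j).2.1)
    linarith
  · intro E h
    have h1 := h.comp hsub
    have h2 : Tendsto (fun j : ℕ => c + (j : ℝ)) atTop atTop :=
      tendsto_atTop_add_const_left _ _ tendsto_natCast_atTop_atTop
    refine not_tendsto_nhds_of_tendsto_atTop (tendsto_atTop_mono (fun j => ?_) h2) E h1
    obtain ⟨h3, -, h5⟩ := hB j
    simp only [Function.comp]
    rw [le_div_iff₀ (by linarith)]
    exact h5

/-! ### The convergence dichotomy -/

/-- At `α = 1` two steps shift both Gamma arguments by exactly one and the sine by half a period, so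
the recursion is exact. This settles the boundary `η = 1/2`, where the ratio test is silent. -/
theorem denTerm_one_add_two {η : ℝ} {m : ℕ} (hη : 0 < η) (hm : 1 ≤ m) (k : ℕ) :
    denTerm 1 m η (k + 2) = -(((k : ℝ) + m) / (2 * η * (k + 1))) * denTerm 1 m η k := by
  have hb : 0 < η / 2 := by positivity
  have hA := shapeA_pos (α := 1) one_pos hm k
  have e1 : shapeA 1 m (k + 2) = shapeA 1 m k + 1 := by unfold shapeA; push_cast; ring
  have e2 : ((k + 2 : ℕ) : ℝ) * (1 / 2) + 1 = ((k : ℝ) * (1 / 2) + 1) + 1 := by push_cast; ring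
  have e3 : Real.sin (((k + 2 : ℕ) : ℝ) * (1 / 2) * Real.pi) =
      -Real.sin ((k : ℝ) * (1 / 2) * Real.pi) := by
    rw [← Real.sin_add_pi]; congr 1; push_cast; ring
  unfold denTerm coeffC
  rw [e1, e2, e3, Real.Gamma_add_one hA.ne', Real.Gamma_add_one (by positivity),
    Real.rpow_add_one hb.ne', Nat.factorial_succ, Nat.factorial_succ]
  have : (η / 2) ^ shapeA 1 m k ≠ 0 := by positivity
  have := Real.pi_pos
  rw [show shapeA 1 m k = ((k : ℝ) + m) / 2 by unfold shapeA; ring] at *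
  push_cast
  field_simp
  ring

/-- Either the terms are absolutely summable, or they do not tend to zero and the quotient of the
partial sums does not converge. -/
theorem summable_or_not_tendsto {α η : ℝ} {m : ℕ} (hα0 : 0 < α) (hα2 : α < 2) (hη : 0 < η)
    (hm : 1 ≤ m) :
    (Summable (termSize α m η) ∧ Summable (termSize α (m + 2) η)) ∨
      (¬ Tendsto (denTerm α m η) atTop (𝓝 0) ∧ ∀ E : ℝ, ¬ Tendsto (fun n =>
        partialSum (numTerm α m η) n / partialSum (denTerm α m η) n) atTop (𝓝 E)) := by
  have hnum : numTerm α m η = fun k => shapeA α m k / (η / 2) * denTerm α m η k :=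
    funext fun k => numTerm_eq_mul_denTerm hα0 hη hm k
  rcases lt_trichotomy α 1 with h | rfl | h
  · exact Or.inl ⟨summable_termSize_of_lt_one hα0 h hη hm,
      summable_termSize_of_lt_one hα0 h hη (by omega)⟩
  · rcases lt_or_ge (1 / 2) η with h | h
    · exact Or.inl ⟨summable_termSize_one h hm, summable_termSize_one h (by omega)⟩
    · right
      have hm' : (1 : ℝ) ≤ m := by exact_mod_cast hm
      have heven : ∀ k, denTerm 1 m η (2 * k) = 0 := by
        intro k
        rw [denTerm_eq]
        have : Real.sin (((2 * k : ℕ) : ℝ) * (1 / 2) * Real.pi) = 0 := by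
          rw [← Real.sin_nat_mul_pi k]; congr 1; push_cast; ring
        rw [this]; ring
      have hρ : ∀ k : ℕ, 1 ≤ ((k : ℝ) + m) / (2 * η * (k + 1)) := by
        intro k
        rw [one_le_div (by positivity)]
        -- Here `2η ≤ 1` and `m ≥ 1` give `2η (k + 1) ≤ k + 1 ≤ k + m`.
        have : (0 : ℝ) ≤ k := by positivity
        nlinarith
      have hd1 : 0 < denTerm 1 m η 1 := by
        rw [denTerm_eq]
        have : Real.sin (((1 : ℕ) : ℝ) * (1 / 2) * Real.pi) = 1 := by
          rw [show ((1 : ℕ) : ℝ) * (1 / 2) * Real.pi = Real.pi / 2 by push_cast; ring,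
            Real.sin_pi_div_two]
        rw [this]
        simpa using termSize_pos (α := 1) one_pos hη hm 1
      obtain ⟨h1, h2⟩ := not_tendsto_of_alternating heven (denTerm_one_add_two hη hm) hρ hd1
        ((m : ℝ) / 2)
      -- The criterion uses the weights `m / 2 + k / 2`; the numerator carries a further factor `1 /
      -- (η / 2)`.
      refine ⟨h1, fun E hE => h2 (E * (η / 2)) ?_⟩
      refine (hE.mul_const (η / 2)).congr fun n => ?_
      rw [hnum, div_mul_eq_mul_div]
      congr 1
      unfold partialSum
      rw [Finset.sum_mul]
      refine Finset.sum_congr rfl fun k _ => ?_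
      unfold shapeA
      field_simp
      ring
  · right
    have hsin : 0 < Real.sin (α / 2 * Real.pi) :=
      Real.sin_pos_of_pos_of_lt_pi (by positivity) (by nlinarith [Real.pi_pos])
    have ht := termSize_pos hα0 hη hm
    have hr := tendsto_termSize_ratio_atTop h hα2 hη hm
    have hd : ∃ᶠ n in atTop,
        |Real.sin (α / 2 * Real.pi)| / 2 * termSize α m η n ≤ |denTerm α m η n| := by
      refine (frequently_le_abs_sin (α / 2 * Real.pi)).mono fun n hn => ?_
      rw [abs_denTerm hα0 hη hm, mul_assoc]
      exact mul_le_mul_of_nonneg_right hn (ht n).le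
    have hs : 0 < |Real.sin (α / 2 * Real.pi)| / 2 := by positivity
    refine ⟨not_tendsto_zero_of_dominant ht hr hs hd, fun E => ?_⟩
    rw [hnum]
    refine not_tendsto_ratio_of_dominant ht hr hs (abs_denTerm_le hα0 hη hm) hd
      (fun n => div_pos (shapeA_pos hα0 hm n) (by positivity)) ?_
      ((tendsto_shapeA hα0 m).atTop_div_const (by positivity)) E
    refine monotone_nat_of_le_succ fun n => ?_
    rw [shapeA_succ]
    gcongr
    linarith

end SGaS

/-! ### Almost everywhere Fourier inversion -/

section

open scoped FourierTransform ContDiff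

/-- No continuity of `f` is needed: both sides are tested against smooth compactly supported `g = 𝓕
ψ` with `ψ` Schwartz. Moving the transforms across, both integrals become `∫ ψ • 𝓕 f`. -/
theorem MeasureTheory.Integrable.ae_eq_fourierInv_fourier {f : ℝ → ℂ} (hf : Integrable f)
    (h'f : Integrable (𝓕 f)) : ∀ᵐ y, f y = 𝓕⁻ (𝓕 f) y := by
  have hcont : Continuous (𝓕⁻ (𝓕 f)) := by
    have := VectorFourier.fourierIntegral_continuous (μ := volume) (L := -innerₗ ℝ)
      Real.continuous_fourierChar (continuous_inner.neg) h'f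
    exact this
  refine ae_eq_of_integral_contDiff_smul_eq hf.locallyIntegrable hcont.locallyIntegrable ?_
  intro g hg hgs
  have hgc : ContDiff ℝ ∞ (fun x => (g x : ℂ)) := Complex.ofRealCLM.contDiff.comp hg
  have hgcs : HasCompactSupport (fun x => (g x : ℂ)) := hgs.comp_left Complex.ofReal_zero
  let H : SchwartzMap ℝ ℂ := hgcs.toSchwartzMap hgc
  let ψ : SchwartzMap ℝ ℂ := 𝓕⁻ H
  have hψ : 𝓕 (ψ : ℝ → ℂ) = H := by
    rw [← SchwartzMap.fourier_coe]; simp [ψ]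
  have hψ' : (ψ : ℝ → ℂ) = 𝓕⁻ (H : ℝ → ℂ) := by
    rw [← SchwartzMap.fourierInv_coe]
  have hH : ∀ x, H x = (g x : ℂ) := fun x => rfl
  have h1 : ∫ x, H x • f x = ∫ x, ψ x • 𝓕 f x := by
    rw [← hψ]
    simpa using! (VectorFourier.integral_fourierIntegral_smul_eq_flip (L := innerₗ ℝ)
      Real.continuous_fourierChar continuous_inner (ψ.integrable (μ := volume)) hf)
  have h2 : ∫ x, H x • 𝓕⁻ (𝓕 f) x = ∫ x, ψ x • 𝓕 f x := by
    rw [hψ']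
    have := (VectorFourier.integral_fourierIntegral_smul_eq_flip (L := -innerₗ ℝ)
      Real.continuous_fourierChar continuous_inner.neg (H.integrable (μ := volume)) h'f).symm
    refine Eq.trans ?_ this
    have e : (-innerₗ ℝ : ℝ →ₗ[ℝ] ℝ →ₗ[ℝ] ℝ).flip = -innerₗ ℝ := by
      ext; simp
    rw [e]
    rfl
  have h3 := h1.trans h2.symm
  simpa [hH] using h3

end

/-! ### Laplace transform of a stretched exponential -/

namespace SGaS

theorem integrableOn_rpow_mul_exp_neg_mul {p b : ℝ} (hp : -1 < p) (hb : 0 < b) :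
    IntegrableOn (fun t : ℝ => t ^ p * Real.exp (-(b * t))) (Set.Ioi 0) := by
  have h := integrableOn_rpow_mul_exp_neg_mul_rpow (p := 1) hp one_pos hb
  simpa using h

theorem integral_rpow_mul_exp_neg_mul {p b : ℝ} (hp : -1 < p) (hb : 0 < b) :
    ∫ t in Set.Ioi (0 : ℝ), t ^ p * Real.exp (-(b * t)) = b ^ (-(p + 1)) * Real.Gamma (p + 1) := by
  have h := Real.integral_rpow_mul_exp_neg_mul_Ioi (a := p + 1) (by linarith) hb
  rw [add_sub_cancel_right] at h
  rw [h, one_div, Real.inv_rpow hb.le, Real.rpow_neg hb.le]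

/-- The Gamma integral scaled by a complex number with positive real part. -/
theorem integral_rpow_mul_cexp_neg_mul {p : ℝ} (hp : -1 < p) {r : ℂ} (hr : 0 < r.re) :
    ∫ t in Set.Ioi (0 : ℝ), ((t ^ p : ℝ) : ℂ) * Complex.exp (-(r * t)) =
      r ^ (((-(p + 1) : ℝ) : ℂ)) * (Real.Gamma (p + 1) : ℂ) := by
  -- With `t ^ p` as the density of a measure, the integral is a complex moment generating function,
  -- hence analytic on the left half-plane; the identity theorem extends the formula from the
  -- negative reals.
  set w : ℝ → ENNReal := fun t => ENNReal.ofReal (t ^ p) with hw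
  have hwm : Measurable w := by fun_prop
  have hwt : ∀ t, w t < ⊤ := fun t => ENNReal.ofReal_lt_top
  set μ : Measure ℝ := (volume.restrict (Set.Ioi (0 : ℝ))).withDensity w with hμ
  have hint : ∀ x : ℝ, x < 0 → Integrable (fun t => Real.exp (x * t)) μ := by
    intro x hx
    rw [hμ, integrable_withDensity_iff hwm (Eventually.of_forall hwt)]
    refine (integrableOn_rpow_mul_exp_neg_mul hp (neg_pos.2 hx)).congr_fun ?_ measurableSet_Ioi
    intro t ht
    have : 0 ≤ t ^ p := Real.rpow_nonneg (le_of_lt ht) _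
    simp only [hw, ENNReal.toReal_ofReal this]
    rw [mul_comm]; ring_nf
  have hmgf : ∀ z : ℂ, ProbabilityTheory.complexMGF id μ z =
      ∫ t in Set.Ioi (0 : ℝ), ((t ^ p : ℝ) : ℂ) * Complex.exp (z * t) := by
    intro z
    unfold ProbabilityTheory.complexMGF
    rw [hμ, integral_withDensity_eq_integral_toReal_smul hwm (Eventually.of_forall hwt)]
    refine setIntegral_congr_fun measurableSet_Ioi fun t ht => ?_
    have : 0 ≤ t ^ p := Real.rpow_nonneg (le_of_lt ht) _
    simp [hw, ENNReal.toReal_ofReal this]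
  set U : Set ℂ := {z | z.re < 0} with hU
  have hUsub : ∀ z ∈ U, z.re ∈ interior (ProbabilityTheory.integrableExpSet id μ) := by
    intro z hz
    exact interior_maximal (fun x hx => hint x hx) isOpen_Iio hz
  have hf : AnalyticOnNhd ℂ (ProbabilityTheory.complexMGF id μ) U :=
    ProbabilityTheory.analyticOnNhd_complexMGF.mono hUsub
  have hg : AnalyticOnNhd ℂ
      (fun z : ℂ => (-z) ^ (((-(p + 1) : ℝ) : ℂ)) * (Real.Gamma (p + 1) : ℂ)) U := by
    intro z hz
    have hz' : -z ∈ Complex.slitPlane := Or.inl (by simpa [hU] using hz)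
    exact (analyticAt_id.neg.cpow analyticAt_const hz').mul analyticAt_const
  have hconv : IsPreconnected U := (convex_halfSpace_re_lt 0).isPreconnected
  have h₀ : (-1 : ℂ) ∈ U := by simp [hU]
  have hreal : ∀ x : ℝ, x < 0 → ProbabilityTheory.complexMGF id μ x =
      (-(x : ℂ)) ^ (((-(p + 1) : ℝ) : ℂ)) * (Real.Gamma (p + 1) : ℂ) := by
    intro x hx
    have h := integral_rpow_mul_exp_neg_mul hp (neg_pos.2 hx)
    rw [hmgf, ← Complex.ofReal_neg, ← Complex.ofReal_cpow (neg_pos.2 hx).le, ← Complex.ofReal_mul,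
      ← h, ← integral_complex_ofReal]
    refine setIntegral_congr_fun measurableSet_Ioi fun t _ => ?_
    simp
  have hfreq : ∃ᶠ z in 𝓝[≠] (-1 : ℂ), ProbabilityTheory.complexMGF id μ z =
      (-z) ^ (((-(p + 1) : ℝ) : ℂ)) * (Real.Gamma (p + 1) : ℂ) := by
    have htend : Tendsto (fun x : ℝ => (x : ℂ)) (𝓝[<] (-1 : ℝ)) (𝓝[≠] (-1 : ℂ)) := by
      refine tendsto_nhdsWithin_iff.2 ⟨?_, ?_⟩
      · have := (Complex.continuous_ofReal.tendsto (-1 : ℝ)).mono_left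
          (nhdsWithin_le_nhds (s := Set.Iio (-1 : ℝ)))
        simpa using this
      · filter_upwards [self_mem_nhdsWithin] with x hx
        have hx' : x < -1 := hx
        intro h
        have : x = -1 := by
          have h' : (x : ℂ) = ((-1 : ℝ) : ℂ) := by simpa using h
          exact_mod_cast h'
        linarith
    refine htend.frequently (Eventually.frequently ?_)
    filter_upwards [self_mem_nhdsWithin] with x hx
    exact hreal x (lt_trans hx (by norm_num))
  have := hf.eqOn_of_preconnected_of_frequently_eq hg hconv h₀ hfreq
    (show -r ∈ U by simpa [hU] using hr)
  simpa [hmgf] using this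

/-- The `k`-th coefficient in the expansion of the Laplace transform of `exp (-z t ^ β)`. -/
noncomputable def laplaceTerm (β : ℝ) (z r : ℂ) (k : ℕ) : ℂ :=
  (-z) ^ k / (k.factorial : ℂ) *
    (r ^ (((-((k : ℝ) * β + 1) : ℝ) : ℂ)) * (Real.Gamma ((k : ℝ) * β + 1) : ℂ))

theorem norm_laplaceTerm {β : ℝ} (hβ0 : 0 < β) {z : ℂ} (hz : ‖z‖ = 1) (r : ℂ) (k : ℕ) :
    ‖laplaceTerm β z r k‖ =
      Real.Gamma ((k : ℝ) * β + 1) / k.factorial * ‖r‖ ^ (-((k : ℝ) * β + 1)) := by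
  have hG : 0 < Real.Gamma ((k : ℝ) * β + 1) := Real.Gamma_pos_of_pos (by positivity)
  unfold laplaceTerm
  rw [norm_mul, norm_mul, norm_div, norm_pow, norm_neg, hz, Complex.norm_cpow_real,
    Complex.norm_real, Real.norm_of_nonneg hG.le, Complex.norm_natCast]
  ring

theorem summable_laplace_bound {β b : ℝ} (hβ0 : 0 < β) (hβ1 : β < 1) (hb : 0 < b) :
    Summable fun k : ℕ =>
      Real.Gamma ((k : ℝ) * β + 1) / k.factorial * b ^ (-((k : ℝ) * β + 1)) := by
  have h := (summable_gamma_div_factorial hβ0 hβ1 (inv_pos.2 hb)).mul_right b⁻¹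
  refine h.congr fun k => ?_
  rw [Real.rpow_neg hb.le, Real.rpow_add_one hb.ne', Real.inv_rpow hb.le, mul_inv, mul_assoc]

/-- Expand `exp (-z t ^ β)` and integrate termwise. A positive real part of `r` makes the integrals
of the norms finite, and `β < 1` makes them summable. -/
theorem hasSum_laplaceTerm {β : ℝ} (hβ0 : 0 < β) (hβ1 : β < 1) {z : ℂ} (hz : ‖z‖ = 1) {r : ℂ}
    (hr : 0 < r.re) :
    HasSum (laplaceTerm β z r)
      (∫ t in Set.Ioi (0 : ℝ), Complex.exp (-(r * t)) * Complex.exp (-(z * (t ^ β : ℝ)))) := by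
  set F : ℕ → ℝ → ℂ := fun k t =>
    (-z) ^ k / (k.factorial : ℂ) * (((t ^ ((k : ℝ) * β) : ℝ) : ℂ) * Complex.exp (-(r * t))) with hF
  have hp : ∀ k : ℕ, -1 < (k : ℝ) * β := fun k => by
    have : 0 ≤ (k : ℝ) * β := by positivity
    linarith
  have hnorm : ∀ k : ℕ, ∀ t ∈ Set.Ioi (0 : ℝ), ‖F k t‖ =
      (k.factorial : ℝ)⁻¹ * (t ^ ((k : ℝ) * β) * Real.exp (-(r.re * t))) := by
    intro k t ht
    have : 0 ≤ t ^ ((k : ℝ) * β) := Real.rpow_nonneg (le_of_lt ht) _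
    simp only [hF, norm_mul, norm_div, norm_pow, norm_neg, hz, Complex.norm_real,
      Real.norm_of_nonneg this, Complex.norm_exp, Complex.norm_natCast]
    simp
  have hmeas : ∀ k, AEStronglyMeasurable (F k) (volume.restrict (Set.Ioi (0 : ℝ))) := by
    intro k
    refine Measurable.aestronglyMeasurable ?_
    simp only [hF]
    fun_prop
  have hint : ∀ k, Integrable (F k) (volume.restrict (Set.Ioi (0 : ℝ))) := by
    intro k
    have h := (integrableOn_rpow_mul_exp_neg_mul (hp k) hr).const_mul (k.factorial : ℝ)⁻¹
    refine Integrable.mono' h (hmeas k) ?_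
    filter_upwards [ae_restrict_mem measurableSet_Ioi] with t ht
    exact (hnorm k t ht).le
  have hsum : Summable fun k => ∫ t in Set.Ioi (0 : ℝ), ‖F k t‖ := by
    refine (summable_laplace_bound hβ0 hβ1 hr).congr fun k => ?_
    rw [setIntegral_congr_fun measurableSet_Ioi (hnorm k), integral_const_mul,
      integral_rpow_mul_exp_neg_mul (hp k) hr]
    field_simp
  have h := hasSum_integral_of_summable_integral_norm hint hsum
  have hterm : ∀ k, ∫ t in Set.Ioi (0 : ℝ), F k t = laplaceTerm β z r k := by
    intro k
    simp only [hF]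
    rw [integral_const_mul, integral_rpow_mul_cexp_neg_mul (hp k) hr]
    rfl
  simp only [hterm] at h
  refine (congrArg (HasSum (laplaceTerm β z r))
    (setIntegral_congr_fun measurableSet_Ioi fun t ht => ?_)).mpr h
  have h1 : HasSum (fun k : ℕ => (-(z * (t ^ β : ℝ))) ^ k / (k.factorial : ℂ))
      (Complex.exp (-(z * (t ^ β : ℝ)))) := by
    rw [Complex.exp_eq_exp_ℂ]
    exact NormedSpace.expSeries_div_hasSum_exp _
  have h2 := h1.mul_left (Complex.exp (-(r * t)))
  refine (h2.tsum_eq.symm).trans (tsum_congr fun k => ?_)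
  simp only [hF]
  have e : t ^ ((k : ℝ) * β) = (t ^ β) ^ k := by
    rw [mul_comm, Real.rpow_mul (le_of_lt ht), Real.rpow_natCast]
  rw [e]
  push_cast
  rw [neg_mul_eq_neg_mul z, mul_pow]
  ring

theorem integrableOn_exp_neg_mul_rpow {β c : ℝ} (hβ0 : 0 < β) (hc : 0 < c) :
    IntegrableOn (fun t : ℝ => Real.exp (-(c * t ^ β))) (Set.Ioi 0) := by
  have h := integrableOn_rpow_mul_exp_neg_mul_rpow (p := β) (s := 0) (by norm_num) hβ0 hc
  simpa using h

/-- The expansion of the Laplace transform of `exp (-z t ^ β)` extends to the imaginary axis. -/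
theorem hasSum_laplaceTerm_I {β y : ℝ} (hβ0 : 0 < β) (hβ1 : β < 1) {z : ℂ} (hz : ‖z‖ = 1)
    (hz0 : 0 < z.re) (hy : 0 < y) :
    HasSum (laplaceTerm β z (Complex.I * y))
      (∫ t in Set.Ioi (0 : ℝ),
        Complex.exp (-(Complex.I * y * t)) * Complex.exp (-(z * (t ^ β : ℝ)))) := by
  -- The point `I * y` is approached from the right half-plane. As `‖r ε‖ ≥ y`, the series has a
  -- bound uniform in `ε`, while `exp (-(z.re * t ^ β))` dominates the integrals.
  set r : ℝ → ℂ := fun ε => ε + Complex.I * y with hr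
  have hrre : ∀ ε, (r ε).re = ε := fun ε => by simp [hr]
  have hrim : ∀ ε, (r ε).im = y := fun ε => by simp [hr]
  have hr0 : r 0 = Complex.I * y := by simp [hr]
  have hrnorm : ∀ ε, y ≤ ‖r ε‖ := fun ε => by
    have := Complex.abs_im_le_norm (r ε)
    rwa [hrim, abs_of_pos hy] at this
  have hrcont : Continuous r := by fun_prop
  have hbound : ∀ ε k, ‖laplaceTerm β z (r ε) k‖ ≤
      Real.Gamma ((k : ℝ) * β + 1) / k.factorial * y ^ (-((k : ℝ) * β + 1)) := by
    intro ε k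
    rw [norm_laplaceTerm hβ0 hz]
    have hG : 0 < Real.Gamma ((k : ℝ) * β + 1) := Real.Gamma_pos_of_pos (by positivity)
    have hk : 0 ≤ (k : ℝ) * β := by positivity
    gcongr ?_ * ?_
    exact Real.rpow_le_rpow_of_nonpos hy (hrnorm ε) (by linarith)
  have hs0 := summable_laplace_bound hβ0 hβ1 hy
  have hsummable : Summable (laplaceTerm β z (Complex.I * y)) :=
    Summable.of_norm_bounded hs0 fun k => by rw [← hr0]; exact hbound 0 k
  have hlim1 : Tendsto (fun ε => ∑' k, laplaceTerm β z (r ε) k) (𝓝[>] 0)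
      (𝓝 (∑' k, laplaceTerm β z (Complex.I * y) k)) := by
    refine tendsto_tsum_of_dominated_convergence hs0 (fun k => ?_)
      (Eventually.of_forall fun ε k => hbound ε k)
    have hslit : r 0 ∈ Complex.slitPlane := Or.inr (by rw [hrim]; exact hy.ne')
    have hcont : ContinuousAt (fun ε => laplaceTerm β z (r ε) k) 0 := by
      unfold laplaceTerm
      exact continuousAt_const.mul
        ((hrcont.continuousAt.cpow continuousAt_const hslit).mul continuousAt_const)
    have := hcont.tendsto.mono_left (nhdsWithin_le_nhds (s := Set.Ioi (0 : ℝ)))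
    rwa [hr0] at this
  have hlim2 : Tendsto (fun ε => ∫ t in Set.Ioi (0 : ℝ),
      Complex.exp (-(r ε * t)) * Complex.exp (-(z * (t ^ β : ℝ)))) (𝓝[>] 0)
      (𝓝 (∫ t in Set.Ioi (0 : ℝ),
        Complex.exp (-(Complex.I * y * t)) * Complex.exp (-(z * (t ^ β : ℝ))))) := by
    refine tendsto_integral_filter_of_dominated_convergence
      (fun t => Real.exp (-(z.re * t ^ β))) ?_ ?_ (integrableOn_exp_neg_mul_rpow hβ0 hz0) ?_
    · refine Eventually.of_forall fun ε => Measurable.aestronglyMeasurable ?_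
      fun_prop
    · filter_upwards [self_mem_nhdsWithin] with ε hε
      filter_upwards [ae_restrict_mem measurableSet_Ioi] with t ht
      have h1 : ‖Complex.exp (-(r ε * t))‖ ≤ 1 := by
        rw [Complex.norm_exp]
        have : (-(r ε * t)).re = -(ε * t) := by simp [hrre]
        rw [this]
        exact Real.exp_le_one_iff.2 (by have := mul_pos (Set.mem_Ioi.1 hε) ht; linarith)
      have h2 : ‖Complex.exp (-(z * (t ^ β : ℝ)))‖ = Real.exp (-(z.re * t ^ β)) := by
        rw [Complex.norm_exp]
        congr 1
        rw [Complex.neg_re, Complex.re_mul_ofReal]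
      rw [norm_mul, h2]
      exact mul_le_of_le_one_left (Real.exp_pos _).le h1
    · refine Eventually.of_forall fun t => ?_
      have hcont : Continuous fun ε =>
          Complex.exp (-(r ε * t)) * Complex.exp (-(z * (t ^ β : ℝ))) := by fun_prop
      have := (hcont.tendsto 0).mono_left (nhdsWithin_le_nhds (s := Set.Ioi (0 : ℝ)))
      rwa [hr0] at this
  have heq : ∀ᶠ ε in 𝓝[>] (0 : ℝ), ∑' k, laplaceTerm β z (r ε) k =
      ∫ t in Set.Ioi (0 : ℝ), Complex.exp (-(r ε * t)) * Complex.exp (-(z * (t ^ β : ℝ))) := by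
    filter_upwards [self_mem_nhdsWithin] with ε hε
    exact (hasSum_laplaceTerm hβ0 hβ1 hz (by rw [hrre]; exact hε)).tsum_eq
  rw [← tendsto_nhds_unique (hlim1.congr' heq) hlim2]
  exact hsummable.hasSum

end SGaS

/-! ### Integral and series representations of the mixing density -/

section

open scoped FourierTransform

namespace SGaS

theorem integrable_comp_abs {f : ℝ → ℝ} (hf : IntegrableOn f (Set.Ioi 0)) :
    Integrable fun x => f |x| := by
  have h1 : IntegrableOn (fun x => f |x|) (Set.Ioi 0) :=
    hf.congr_fun (fun x hx => by rw [abs_of_pos hx]) measurableSet_Ioi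
  have h2 : IntegrableOn (fun x => f |x|) (Set.Iic 0) := by
    have hemb : MeasurableEmbedding fun x : ℝ => -x := (Homeomorph.neg ℝ).measurableEmbedding
    rw [← Measure.map_neg_eq_self (volume : Measure ℝ), hemb.integrableOn_map_iff]
    have h3 : IntegrableOn (fun x => f |x|) (Set.Ici 0) := by
      rwa [integrableOn_Ici_iff_integrableOn_Ioi]
    simpa [Function.comp_def] using h3
  rw [← integrableOn_univ, ← Set.Iic_union_Ioi (a := (0 : ℝ))]
  exact h2.union h1

theorem cos_pi_mul_div_four_pos {α : ℝ} (hα0 : 0 < α) (hα2 : α < 2) : 0 < Real.cos (Real.pi * α / 4) :=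
  Real.cos_pos_of_mem_Ioo ⟨by nlinarith [Real.pi_pos], by nlinarith [Real.pi_pos]⟩

/-- The scale satisfies `γ ^ (α / 2) = cos (π α / 4)`, which cancels the denominator of the tangent.
-/
theorem stableCharFun_mixing {α : ℝ} (hα0 : 0 < α) (hα2 : α < 2) (θ : ℝ) :
    stableCharFun (α / 2) 1 (Real.cos (Real.pi * α / 4) ^ (2 / α)) 0 θ =
      Complex.exp (((-(Real.cos (Real.pi * α / 4) * |θ| ^ (α / 2)) : ℝ) : ℂ) +
        ((Real.sin (Real.pi * α / 4) * |θ| ^ (α / 2) * Real.sign θ : ℝ) : ℂ) * Complex.I) := by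
  have hc := cos_pi_mul_div_four_pos hα0 hα2
  unfold stableCharFun
  rw [if_pos (by linarith : α / 2 < 1).ne, ← Real.rpow_mul hc.le,
    show 2 / α * (α / 2) = 1 by field_simp, Real.rpow_one,
    show Real.pi * (α / 2) / 2 = Real.pi * α / 4 by ring, Real.tan_eq_sin_div_cos]
  congr 1
  push_cast
  have hc' : Complex.cos (Real.pi * α / 4) ≠ 0 := by
    have : ((Real.cos (Real.pi * α / 4) : ℝ) : ℂ) ≠ 0 := by exact_mod_cast hc.ne'
    simpa using this
  field_simp
  ring

theorem IsStablePDF.integrable {α β γ δ : ℝ} {S : ℝ → ℝ} (hS : IsStablePDF α β γ δ S) :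
    Integrable S := by
  refine ⟨hS.measurable.aestronglyMeasurable, ?_⟩
  rw [hasFiniteIntegral_iff_ofReal (Eventually.of_forall hS.nonneg)]
  have h := hS.isProbabilityMeasure.measure_univ
  rw [withDensity_apply _ MeasurableSet.univ, Measure.restrict_univ] at h
  rw [h]
  exact ENNReal.one_lt_top

theorem IsStablePDF.fourier_eq {α β γ δ : ℝ} {S : ℝ → ℝ} (hS : IsStablePDF α β γ δ S) (w : ℝ) :
    𝓕 (fun y => (S y : ℂ)) w = stableCharFun α β γ δ (-2 * Real.pi * w) := by
  rw [← hS.charFun_eq, charFun_apply_real, Real.fourier_real_eq_integral_exp_smul,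
    integral_withDensity_eq_integral_toReal_smul hS.measurable.ennreal_ofReal
      (Eventually.of_forall fun _ => ENNReal.ofReal_lt_top)]
  refine integral_congr_ae (Eventually.of_forall fun y => ?_)
  simp only [ENNReal.toReal_ofReal (hS.nonneg y), Complex.real_smul, smul_eq_mul]
  rw [mul_comm]
  congr 2
  push_cast
  ring

/-- The real integral representation of the mixing density. -/
theorem IsMixingDensity.ae_eq_integral {α : ℝ} {S : ℝ → ℝ} (hα0 : 0 < α) (hα2 : α < 2)
    (hS : IsMixingDensity α S) :
    ∀ᵐ y : ℝ, S y = Real.pi⁻¹ * ∫ t in Set.Ioi (0 : ℝ),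
      Real.exp (-(Real.cos (Real.pi * α / 4) * t ^ (α / 2))) *
        Real.cos (Real.sin (Real.pi * α / 4) * t ^ (α / 2) - t * y) := by
  set c := Real.cos (Real.pi * α / 4) with hc
  set s := Real.sin (Real.pi * α / 4) with hs
  have hc0 : 0 < c := cos_pi_mul_div_four_pos hα0 hα2
  have hβ0 : 0 < α / 2 := by positivity
  set φ : ℝ → ℂ := fun θ => Complex.exp (((-(c * |θ| ^ (α / 2)) : ℝ) : ℂ) +
    ((s * |θ| ^ (α / 2) * Real.sign θ : ℝ) : ℂ) * Complex.I) with hφ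
  have hφS : ∀ w, 𝓕 (fun y => (S y : ℂ)) w = φ (-2 * Real.pi * w) := fun w => by
    rw [IsStablePDF.fourier_eq hS, stableCharFun_mixing hα0 hα2]
  have hφnorm : ∀ θ, ‖φ θ‖ = Real.exp (-(c * |θ| ^ (α / 2))) := fun θ => by
    simp only [hφ, Complex.norm_exp]
    congr 1
    simp
  have hsign : Measurable Real.sign := by
    unfold Real.sign
    exact Measurable.ite measurableSet_Iio measurable_const
      (Measurable.ite measurableSet_Ioi measurable_const measurable_const)
  have hφm : Measurable φ := by
    simp only [hφ]
    fun_prop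
  have hφint : Integrable φ := by
    have h := integrable_comp_abs (integrableOn_exp_neg_mul_rpow hβ0 hc0)
    exact Integrable.mono' h hφm.aestronglyMeasurable
      (Eventually.of_forall fun θ => (hφnorm θ).le)
  have hFint : Integrable (𝓕 (fun y => (S y : ℂ))) := by
    have h : Integrable fun w => φ (-2 * Real.pi * w) :=
      hφint.comp_mul_left' (by simp [Real.pi_ne_zero])
    exact h.congr (Eventually.of_forall fun w => (hφS w).symm)
  have hSint : Integrable (fun y => (S y : ℂ)) := (IsStablePDF.integrable hS).ofReal
  filter_upwards [hSint.ae_eq_fourierInv_fourier hFint] with y hy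
  rw [Real.fourierInv_eq'] at hy
  set ψ : ℝ → ℂ := fun θ => Complex.exp ((-(θ * y) : ℝ) * Complex.I) * φ θ with hψ
  have hψint : Integrable ψ := by
    refine Integrable.mono' hφint.norm ?_ (Eventually.of_forall fun θ => ?_)
    · refine Measurable.aestronglyMeasurable ?_
      simp only [hψ]
      fun_prop
    · simp only [hψ, norm_mul, Complex.norm_exp_ofReal_mul_I, one_mul, le_refl]
  have hy2 : (S y : ℂ) = ∫ w, ψ (-2 * Real.pi * w) := by
    rw [hy]
    refine integral_congr_ae (Eventually.of_forall fun w => ?_)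
    simp only [hφS, hψ, smul_eq_mul]
    congr 3
    simp
    ring
  rw [Measure.integral_comp_mul_left] at hy2
  have hy3 : S y = |(-2 * Real.pi)⁻¹| * ∫ θ, (ψ θ).re := by
    have h := congrArg Complex.re hy2
    rw [Complex.ofReal_re, Complex.smul_re] at h
    rw [h, smul_eq_mul]
    congr 1
    exact (integral_re hψint).symm
  -- The sign of `θ` in the phase makes the real part even, so the integral folds onto the positive
  -- half-line.
  have hre : ∀ θ, (ψ θ).re = (fun t => Real.exp (-(c * t ^ (α / 2))) *
      Real.cos (s * t ^ (α / 2) - t * y)) |θ| := by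
    intro θ
    simp only [hψ, hφ]
    rw [← Complex.exp_add, Complex.exp_re]
    have h1 : (((-(θ * y) : ℝ) : ℂ) * Complex.I + (((-(c * |θ| ^ (α / 2)) : ℝ) : ℂ) +
      ((s * |θ| ^ (α / 2) * Real.sign θ : ℝ) : ℂ) * Complex.I)).re = -(c * |θ| ^ (α / 2)) := by
      simp
    have h2 : (((-(θ * y) : ℝ) : ℂ) * Complex.I + (((-(c * |θ| ^ (α / 2)) : ℝ) : ℂ) +
      ((s * |θ| ^ (α / 2) * Real.sign θ : ℝ) : ℂ) * Complex.I)).im =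
        s * |θ| ^ (α / 2) * Real.sign θ - θ * y := by
      simp; ring
    rw [h1, h2]
    congr 1
    rcases lt_trichotomy θ 0 with h | rfl | h
    · rw [Real.sign_of_neg h, abs_of_neg h, ← Real.cos_neg]
      congr 1
      ring
    · simp [Real.zero_rpow hβ0.ne']
    · rw [Real.sign_of_pos h, abs_of_pos h, mul_one]
  rw [hy3]
  simp only [hre]
  rw [integral_comp_abs (f := fun t => Real.exp (-(c * t ^ (α / 2))) *
      Real.cos (s * t ^ (α / 2) - t * y)), ← mul_assoc]
  congr 1
  have := Real.pi_pos
  rw [abs_inv, abs_mul, abs_of_pos this]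
  norm_num
  field_simp

/-- The series expansion of the mixing density. -/
theorem IsMixingDensity.ae_hasSum {α : ℝ} {S : ℝ → ℝ} (hα0 : 0 < α) (hα2 : α < 2)
    (hS : IsMixingDensity α S) :
    ∀ᵐ y : ℝ, 0 < y →
      HasSum (fun k : ℕ => coeffC α k * y ^ (-((k : ℝ) * (α / 2) + 1))) (S y) := by
  set x : ℝ := Real.pi * α / 4 with hx
  have hc0 : 0 < Real.cos x := cos_pi_mul_div_four_pos hα0 hα2
  have hβ0 : 0 < α / 2 := by positivity
  -- With this `z`, the real part of `exp (-(I y t)) exp (-(z t ^ (α / 2)))` is the integrand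
  -- representing `S`.
  set z : ℂ := Complex.exp ((-x : ℝ) * Complex.I) with hz
  have hznorm : ‖z‖ = 1 := Complex.norm_exp_ofReal_mul_I _
  have hzre : z.re = Real.cos x := by rw [hz, Complex.exp_ofReal_mul_I_re, Real.cos_neg]
  have hzim : z.im = -Real.sin x := by rw [hz, Complex.exp_ofReal_mul_I_im, Real.sin_neg]
  filter_upwards [hS.ae_eq_integral hα0 hα2] with y hy hy0
  have h := hasSum_laplaceTerm_I hβ0 (by linarith) hznorm (by rw [hzre]; exact hc0) hy0
  have hint : Integrable (fun t : ℝ =>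
      Complex.exp (-(Complex.I * y * t)) * Complex.exp (-(z * (t ^ (α / 2) : ℝ))))
      (volume.restrict (Set.Ioi 0)) := by
    refine Integrable.mono' (integrableOn_exp_neg_mul_rpow hβ0 hc0)
      (Measurable.aestronglyMeasurable (by fun_prop)) (Eventually.of_forall fun t => ?_)
    rw [norm_mul, Complex.norm_exp, Complex.norm_exp, Complex.neg_re, Complex.neg_re,
      Complex.re_mul_ofReal, Complex.re_mul_ofReal, Complex.re_mul_ofReal, hzre]
    simp
  have h2 := (Complex.hasSum_re h).mul_left Real.pi⁻¹
  have hI : Real.pi⁻¹ * (∫ t in Set.Ioi (0 : ℝ), Complex.exp (-(Complex.I * y * t)) *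
      Complex.exp (-(z * (t ^ (α / 2) : ℝ)))).re = S y := by
    rw [hy]
    congr 1
    refine (integral_re hint).symm.trans ?_
    refine setIntegral_congr_fun measurableSet_Ioi fun t ht => ?_
    change (Complex.exp (-(Complex.I * y * t)) * Complex.exp (-(z * (t ^ (α / 2) : ℝ)))).re = _
    rw [← Complex.exp_add, Complex.exp_re, Complex.add_re, Complex.add_im, Complex.neg_re,
      Complex.neg_im, Complex.neg_re, Complex.neg_im, Complex.re_mul_ofReal (Complex.I * y), Complex.im_mul_ofReal (Complex.I * y),
      Complex.re_mul_ofReal z, Complex.im_mul_ofReal z, hzre, hzim]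
    rw [← hx]
    simp
    ring_nf
  rw [hI] at h2
  refine (congrArg (HasSum · (S y)) (funext fun k => ?_)).mpr h2
  have hI0 : Complex.I * (y : ℂ) ≠ 0 := by simp [hy0.ne']
  have hlog : Complex.log (Complex.I * (y : ℂ)) =
      (Real.log y : ℝ) + (Real.pi / 2 : ℝ) * Complex.I := by
    rw [mul_comm, Complex.log_ofReal_mul hy0 Complex.I_ne_zero, Complex.log_I]
    push_cast; ring
  set p : ℝ := (k : ℝ) * (α / 2) + 1 with hp
  -- Both `z ^ k` and the power of `I` contribute the phase `-k α π / 4`, and the exponent's extra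
  -- `1` adds `-π / 2`; the latter turns the cosine into the sine of `coeffC`.
  have hpow : (-z) ^ k * (Complex.I * (y : ℂ)) ^ ((-p : ℝ) : ℂ) =
      ((-1 : ℝ) ^ k * y ^ (-p) : ℝ) *
        Complex.exp ((-(Real.pi / 2 + (k : ℝ) * (α / 2) * Real.pi) : ℝ) * Complex.I) := by
    rw [neg_pow, hz, ← Complex.exp_nat_mul, Complex.cpow_def_of_ne_zero hI0, hlog,
      Real.rpow_def_of_pos hy0]
    push_cast
    rw [mul_assoc, mul_assoc, ← Complex.exp_add, ← Complex.exp_add]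
    congr 2
    rw [hx, hp]
    push_cast
    ring
  have hterm : laplaceTerm (α / 2) z (Complex.I * y) k =
      ((Real.Gamma p / k.factorial * ((-1 : ℝ) ^ k * y ^ (-p)) : ℝ) : ℂ) *
        Complex.exp ((-(Real.pi / 2 + (k : ℝ) * (α / 2) * Real.pi) : ℝ) * Complex.I) := by
    unfold laplaceTerm
    rw [Complex.ofReal_mul, mul_assoc, ← hpow, ← hp]
    push_cast
    ring
  rw [hterm, Complex.re_ofReal_mul, Complex.exp_ofReal_mul_I_re, Real.cos_neg,
    add_comm (Real.pi / 2),
    Real.cos_add_pi_div_two]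
  unfold coeffC
  rw [pow_succ, ← hp]
  field_simp

end SGaS

end

/-! ### Integration against the posterior weight -/

namespace SGaS

/-- Raise `x ≤ exp x` at `x = b / (y (p + 1))` to the power `p`; using `p + 1` rather than `p`
covers `p = 0`. The posterior is thereby dominated by a multiple of `S`. -/
theorem rpow_neg_mul_exp_neg_div_le {p b y : ℝ} (hp : 0 ≤ p) (hb : 0 < b) (hy : 0 < y) :
    y ^ (-p) * Real.exp (-(b / y)) ≤ ((p + 1) / b) ^ p := by
  have hq : 0 < p + 1 := by linarith
  have h1 : y⁻¹ ≤ (p + 1) / b * Real.exp (b / y / (p + 1)) := by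
    have h := Real.add_one_le_exp (b / y / (p + 1))
    have h2 : b / y / (p + 1) ≤ Real.exp (b / y / (p + 1)) := by linarith
    have h3 := mul_le_mul_of_nonneg_left h2 (by positivity : 0 ≤ (p + 1) / b)
    refine le_trans (le_of_eq ?_) h3
    field_simp
  have h2 : y ^ (-p) ≤ ((p + 1) / b) ^ p * Real.exp (b / y) := by
    rw [Real.rpow_neg hy.le, ← Real.inv_rpow hy.le]
    refine (Real.rpow_le_rpow (by positivity) h1 hp).trans ?_
    rw [Real.mul_rpow (by positivity) (Real.exp_pos _).le, ← Real.exp_mul]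
    gcongr
    rw [div_mul_eq_mul_div, div_le_iff₀ hq]
    have : 0 < b / y := by positivity
    nlinarith
  calc y ^ (-p) * Real.exp (-(b / y))
      ≤ ((p + 1) / b) ^ p * Real.exp (b / y) * Real.exp (-(b / y)) := by gcongr
    _ = ((p + 1) / b) ^ p := by rw [mul_assoc, ← Real.exp_add]; simp

theorem inv_mul_posterior (m : ℕ) (η : ℝ) (S : ℝ → ℝ) {y : ℝ} (hy : 0 < y) :
    y⁻¹ * posterior m η S y = posterior (m + 2) η S y := by
  unfold posterior
  have : y ^ (-(((m + 2 : ℕ) : ℝ) / 2)) = y⁻¹ * y ^ (-((m : ℝ) / 2)) := by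
    rw [← Real.rpow_neg_one, ← Real.rpow_add hy]
    congr 1
    push_cast
    ring
  rw [this]
  ring

theorem posterior_nonneg {m : ℕ} {η : ℝ} {S : ℝ → ℝ} (hS : ∀ y, 0 ≤ S y) {y : ℝ} (hy : 0 < y) :
    0 ≤ posterior m η S y :=
  mul_nonneg (mul_nonneg (Real.rpow_nonneg hy.le _) (Real.exp_pos _).le) (hS y)

theorem IsStablePDF.integrableOn_posterior {α β γ δ : ℝ} {S : ℝ → ℝ}
    (hS : IsStablePDF α β γ δ S) {m : ℕ} {η : ℝ} (hη : 0 < η) :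
    IntegrableOn (posterior m η S) (Set.Ioi 0) := by
  have hm : Measurable (posterior m η S) := by
    have := hS.measurable
    unfold posterior
    fun_prop
  refine Integrable.mono' ((hS.integrable.integrableOn (s := Set.Ioi 0)).const_mul
    ((((m : ℝ) / 2 + 1) / (η / 2)) ^ ((m : ℝ) / 2))) hm.aestronglyMeasurable ?_
  filter_upwards [ae_restrict_mem measurableSet_Ioi] with y hy
  have hy' : 0 < y := hy
  rw [Real.norm_of_nonneg (posterior_nonneg hS.nonneg hy)]
  unfold posterior
  have h := rpow_neg_mul_exp_neg_div_le (p := (m : ℝ) / 2) (b := η / 2) (by positivity)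
    (by positivity) hy'
  rw [show η / 2 / y = η / (2 * y) by field_simp] at h
  exact mul_le_mul_of_nonneg_right h (hS.nonneg y)

/-- The substitution `t = y⁻¹`, Jacobian included, which reduces inverse Gamma integrals to Gamma
integrals. -/
theorem smul_rpow_neg_one_comp {a b y : ℝ} (hy : 0 < y) :
    (|(-1 : ℝ)| * y ^ ((-1 : ℝ) - 1)) • ((y ^ (-1 : ℝ)) ^ (a - 1) *
      Real.exp (-(b * y ^ (-1 : ℝ)))) = y ^ (-(a + 1)) * Real.exp (-(b / y)) := by
  rw [← Real.rpow_mul hy.le, abs_neg, abs_one, one_mul, smul_eq_mul, ← mul_assoc,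
    ← Real.rpow_add hy, Real.rpow_neg_one, ← div_eq_mul_inv]
  ring_nf

theorem integrableOn_inverseGamma {a b : ℝ} (ha : 0 < a) (hb : 0 < b) :
    IntegrableOn (fun y : ℝ => y ^ (-(a + 1)) * Real.exp (-(b / y))) (Set.Ioi 0) := by
  have h := (integrableOn_Ioi_comp_rpow_iff
    (fun t : ℝ => t ^ (a - 1) * Real.exp (-(b * t))) (p := -1) (by norm_num)).2
    (integrableOn_rpow_mul_exp_neg_mul (by linarith) hb)
  exact h.congr_fun (fun y hy => smul_rpow_neg_one_comp hy) measurableSet_Ioi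

theorem integral_inverseGamma {a b : ℝ} (ha : 0 < a) (hb : 0 < b) :
    ∫ y in Set.Ioi (0 : ℝ), y ^ (-(a + 1)) * Real.exp (-(b / y)) = Real.Gamma a / b ^ a := by
  have h := integral_comp_rpow_Ioi
    (fun t : ℝ => t ^ (a - 1) * Real.exp (-(b * t))) (p := -1) (by norm_num)
  rw [setIntegral_congr_fun measurableSet_Ioi fun y hy => smul_rpow_neg_one_comp hy,
    integral_rpow_mul_exp_neg_mul (by linarith) hb] at h
  rw [h, sub_add_cancel, Real.rpow_neg hb.le]
  field_simp

theorem coeffC_zero (α : ℝ) : coeffC α 0 = 0 := by simp [coeffC]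

theorem denTerm_zero (α : ℝ) (m : ℕ) (η : ℝ) : denTerm α m η 0 = 0 := by
  simp [denTerm, coeffC_zero]

/-- `HasSum` runs over all of `ℕ`, while the partial sums start at index one; hence the condition on
`r 0`. -/
theorem seriesSum_of_hasSum {r : ℕ → ℝ} {s : ℝ} (h : HasSum r s) (h0 : r 0 = 0) : SeriesSum r s := by
  have h1 := (tendsto_add_atTop_iff_nat 1).2 h.tendsto_sum_nat
  refine h1.congr fun n => ?_
  induction n with
  | zero => simp [partialSum, h0]
  | succ n ih => rw [Finset.sum_range_succ, ih, partialSum_succ]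

theorem SeriesConverges.tendsto_zero {r : ℕ → ℝ} (h : SeriesConverges r) :
    Tendsto r atTop (𝓝 0) := by
  obtain ⟨s, hs⟩ := h
  have h1 := (hs.comp (tendsto_add_atTop_nat 1)).sub hs
  rw [sub_self] at h1
  rw [← tendsto_add_atTop_iff_nat 1]
  refine h1.congr fun n => ?_
  simp [partialSum_succ]

/-- Term-by-term integration of the posterior density. -/
theorem IsMixingDensity.hasSum_denTerm {α η : ℝ} {m : ℕ} {S : ℝ → ℝ} (hα0 : 0 < α) (hα2 : α < 2)
    (hη : 0 < η) (hm : 1 ≤ m) (hS : IsMixingDensity α S) (hsum : Summable (termSize α m η)) :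
    HasSum (denTerm α m η) (∫ y in Set.Ioi (0 : ℝ), posterior m η S y) := by
  have hb : 0 < η / 2 := by positivity
  set F : ℕ → ℝ → ℝ := fun k y =>
    coeffC α k * (y ^ (-(shapeA α m k + 1)) * Real.exp (-(η / 2 / y))) with hF
  have hA := shapeA_pos hα0 hm
  have hint : ∀ k, Integrable (F k) (volume.restrict (Set.Ioi 0)) := fun k =>
    (integrableOn_inverseGamma (hA k) hb).const_mul _
  have hterm : ∀ k, ∫ y in Set.Ioi (0 : ℝ), F k y = denTerm α m η k := fun k => by
    simp only [hF]
    rw [integral_const_mul, integral_inverseGamma (hA k) hb]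
    rfl
  have hnorm : ∀ k, ∫ y in Set.Ioi (0 : ℝ), ‖F k y‖ = |denTerm α m η k| := fun k => by
    have hG : 0 < Real.Gamma (shapeA α m k) / (η / 2) ^ shapeA α m k :=
      div_pos (Real.Gamma_pos_of_pos (hA k)) (Real.rpow_pos_of_pos hb _)
    rw [denTerm, abs_mul, abs_of_pos hG, ← integral_inverseGamma (hA k) hb, ← integral_const_mul]
    refine setIntegral_congr_fun measurableSet_Ioi fun y hy => ?_
    have : 0 ≤ y ^ (-(shapeA α m k + 1)) := Real.rpow_nonneg (le_of_lt hy) _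
    simp only [hF, norm_mul, Real.norm_eq_abs, abs_of_nonneg this, Real.abs_exp]
  have h := hasSum_integral_of_summable_integral_norm hint
    (Summable.of_nonneg_of_le (fun k => by rw [hnorm]; exact abs_nonneg _)
      (fun k => by rw [hnorm]; exact abs_denTerm_le hα0 hη hm k) hsum)
  simp only [hterm] at h
  refine (congrArg (HasSum (denTerm α m η)) (setIntegral_congr_ae measurableSet_Ioi ?_)).mpr h
  filter_upwards [hS.ae_hasSum hα0 hα2] with y hy hy0
  have hy0' : 0 < y := hy0
  have h1 := (hy hy0).mul_left (y ^ (-((m : ℝ) / 2)) * Real.exp (-(η / (2 * y))))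
  refine h1.tsum_eq.symm.trans (tsum_congr fun k => ?_)
  simp only [hF]
  have e : y ^ (-(shapeA α m k + 1)) =
      y ^ (-((m : ℝ) / 2)) * y ^ (-((k : ℝ) * (α / 2) + 1)) := by
    rw [← Real.rpow_add hy0']
    congr 1
    unfold shapeA
    ring
  rw [e, show η / 2 / y = η / (2 * y) by field_simp]
  ring

theorem coeffC_one_pos {α : ℝ} (hα0 : 0 < α) (hα2 : α < 2) : 0 < coeffC α 1 := by
  have hsin : 0 < Real.sin (α / 2 * Real.pi) :=
    Real.sin_pos_of_pos_of_lt_pi (by positivity) (by nlinarith [Real.pi_pos])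
  have hG : 0 < Real.Gamma (α / 2 + 1) := Real.Gamma_pos_of_pos (by positivity)
  have := Real.pi_pos
  unfold coeffC
  simp only [Nat.cast_one, one_mul, Nat.factorial_one, mul_one]
  norm_num
  positivity

theorem summable_abs_coeffC {α : ℝ} (hα0 : 0 < α) (hα2 : α < 2) :
    Summable fun k => |coeffC α k| := by
  have h := (summable_gamma_div_factorial (β := α / 2) (r := 1) (by positivity) (by linarith)
    one_pos).mul_right Real.pi⁻¹
  refine Summable.of_nonneg_of_le (fun k => abs_nonneg _) (fun k => ?_) h
  have hG : 0 < Real.Gamma ((k : ℝ) * (α / 2) + 1) := Real.Gamma_pos_of_pos (by positivity)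
  have hpi := Real.pi_pos
  unfold coeffC
  rw [abs_mul, abs_mul, abs_pow, abs_neg, abs_one, one_pow, one_mul, Real.one_rpow, mul_one,
    abs_of_pos (by positivity)]
  refine (mul_le_of_le_one_right (by positivity) (Real.abs_sin_le_one _)).trans (le_of_eq ?_)
  field_simp

/-- The mixing density is positive far out. -/
theorem IsMixingDensity.ae_eventually_pos {α : ℝ} {S : ℝ → ℝ} (hα0 : 0 < α) (hα2 : α < 2)
    (hS : IsMixingDensity α S) : ∃ Y : ℝ, 0 < Y ∧ ∀ᵐ y : ℝ, Y < y → 0 < S y := by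
  have hβ0 : 0 < α / 2 := by positivity
  set f : ℝ → ℕ → ℝ := fun y k => coeffC α k * y ^ ((1 - (k : ℝ)) * (α / 2)) with hf
  have hlim : Tendsto (fun y => ∑' k, f y k) atTop
      (𝓝 (∑' k, if k = 1 then coeffC α 1 else 0)) := by
    refine tendsto_tsum_of_dominated_convergence (summable_abs_coeffC hα0 hα2) (fun k => ?_) ?_
    · rcases k with _ | _ | k
      · simp [hf, coeffC_zero]
      · simp [hf]
      · have h := tendsto_rpow_neg_atTop (y := ((k : ℝ) + 1) * (α / 2)) (by positivity)
        have h2 := h.const_mul (coeffC α (k + 2))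
        simp only [mul_zero] at h2
        simp only [hf]
        rw [if_neg (by omega)]
        refine h2.congr fun y => ?_
        push_cast
        ring_nf
    · filter_upwards [eventually_ge_atTop 1] with y hy k
      rcases k with _ | k
      · simp [hf, coeffC_zero]
      · simp only [hf]
        have hy0 : 0 < y := by linarith
        rw [Real.norm_eq_abs, abs_mul, abs_of_pos (Real.rpow_pos_of_pos hy0 _)]
        refine mul_le_of_le_one_right (abs_nonneg _) (Real.rpow_le_one_of_one_le_of_nonpos hy ?_)
        push_cast
        have : 0 ≤ (k : ℝ) * (α / 2) := by positivity
        linarith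
  rw [tsum_ite_eq] at hlim
  obtain ⟨Y, hY⟩ := eventually_atTop.1 (hlim.eventually_const_lt (coeffC_one_pos hα0 hα2))
  refine ⟨max Y 1, by positivity, ?_⟩
  filter_upwards [hS.ae_hasSum hα0 hα2] with y hy hy1
  have hy0 : 0 < y := lt_of_lt_of_le one_pos ((le_max_right _ _).trans hy1.le)
  have h1 := (hy hy0).mul_right (y ^ (α / 2 + 1))
  have h2 : ∑' k, f y k = S y * y ^ (α / 2 + 1) := by
    rw [← h1.tsum_eq]
    refine tsum_congr fun k => ?_
    simp only [hf]
    rw [mul_assoc, ← Real.rpow_add hy0]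
    congr 2
    ring
  have h3 := hY y ((le_max_left _ _).trans hy1.le)
  rw [h2] at h3
  exact pos_of_mul_pos_left h3 (Real.rpow_pos_of_pos hy0 _).le

theorem IsMixingDensity.integral_posterior_pos {α η : ℝ} {m : ℕ} {S : ℝ → ℝ} (hα0 : 0 < α)
    (hα2 : α < 2) (hη : 0 < η) (hS : IsMixingDensity α S) :
    0 < ∫ y in Set.Ioi (0 : ℝ), posterior m η S y := by
  obtain ⟨Y, hY0, hY⟩ := hS.ae_eventually_pos hα0 hα2
  have hnn : 0 ≤ᵐ[volume.restrict (Set.Ioi (0 : ℝ))] posterior m η S := by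
    filter_upwards [ae_restrict_mem measurableSet_Ioi] with y hy
    exact posterior_nonneg (IsStablePDF.nonneg hS) hy
  rw [setIntegral_pos_iff_support_of_nonneg_ae hnn (IsStablePDF.integrableOn_posterior hS hη)]
  have hsub : Set.Ioi Y ≤ᵐ[volume] (Function.support (posterior m η S) ∩ Set.Ioi 0 : Set ℝ) := by
    filter_upwards [hY] with y hy hyY
    have hy0 : 0 < y := hY0.trans hyY
    refine ⟨?_, hy0⟩
    have : 0 < posterior m η S y :=
      mul_pos (mul_pos (Real.rpow_pos_of_pos hy0 _) (Real.exp_pos _)) (hy hyY)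
    exact this.ne'
  refine lt_of_lt_of_le ?_ (measure_mono_ae hsub)
  simp

end SGaS

/-! ### The equivalences -/

theorem theorem3 (α η : ℝ) (m : ℕ) (S : ℝ → ℝ)
    (hα0 : 0 < α) (hα2 : α < 2) (hη : 0 < η) (hm : 1 ≤ m)
    (hS : SGaS.IsMixingDensity α S) :
    -- the expectation is well defined
    (IntegrableOn (fun y => SGaS.posterior m η S y) (Set.Ioi 0) ∧
      IntegrableOn (fun y => y⁻¹ * SGaS.posterior m η S y) (Set.Ioi 0) ∧
      0 < ∫ y in Set.Ioi (0 : ℝ), SGaS.posterior m η S y) ∧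
    -- it is the ratio of the sums of the two series iff both series converge
    ((∃ N D : ℝ, SGaS.SeriesSum (SGaS.numTerm α m η) N ∧
        SGaS.SeriesSum (SGaS.denTerm α m η) D ∧ D ≠ 0 ∧ SGaS.meanInv m η S = N / D) ↔
      SGaS.SeriesConverges (SGaS.numTerm α m η) ∧
        SGaS.SeriesConverges (SGaS.denTerm α m η)) ∧
    -- it is the limit of the ratios of the truncated series iff both series converge
    (Tendsto (fun n => SGaS.partialSum (SGaS.numTerm α m η) n /
        SGaS.partialSum (SGaS.denTerm α m η) n) atTop (𝓝 (SGaS.meanInv m η S)) ↔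
      SGaS.SeriesConverges (SGaS.numTerm α m η) ∧
        SGaS.SeriesConverges (SGaS.denTerm α m η)) := by
  have hpos : 0 < ∫ y in Set.Ioi (0 : ℝ), SGaS.posterior m η S y :=
    hS.integral_posterior_pos hα0 hα2 hη
  have hmean : SGaS.meanInv m η S = (∫ y in Set.Ioi (0 : ℝ), SGaS.posterior (m + 2) η S y) /
      ∫ y in Set.Ioi (0 : ℝ), SGaS.posterior m η S y := by
    unfold SGaS.meanInv
    rw [setIntegral_congr_fun measurableSet_Ioi fun y hy => SGaS.inv_mul_posterior m η S hy]
  refine ⟨⟨SGaS.IsStablePDF.integrableOn_posterior hS hη, ?_, hpos⟩, ?_⟩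
  · exact (SGaS.IsStablePDF.integrableOn_posterior (m := m + 2) hS hη).congr_fun
      (fun y hy => (SGaS.inv_mul_posterior m η S hy).symm) measurableSet_Ioi
  rcases SGaS.summable_or_not_tendsto (m := m) hα0 hα2 hη hm with ⟨h1, h2⟩ | ⟨h1, h2⟩
  · have hD := SGaS.seriesSum_of_hasSum (hS.hasSum_denTerm hα0 hα2 hη hm h1)
      (SGaS.denTerm_zero α m η)
    have hN := SGaS.seriesSum_of_hasSum (hS.hasSum_denTerm hα0 hα2 hη (by omega) h2)
      (SGaS.denTerm_zero α (m + 2) η)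
    rw [← SGaS.numTerm_eq_denTerm_add_two] at hN
    refine ⟨iff_of_true ⟨_, _, hN, hD, hpos.ne', hmean⟩ ⟨⟨_, hN⟩, ⟨_, hD⟩⟩,
      iff_of_true ?_ ⟨⟨_, hN⟩, ⟨_, hD⟩⟩⟩
    rw [hmean]
    exact Filter.Tendsto.div hN hD hpos.ne'
  -- Divergence of the denominator alone refutes (i) and the joint convergence; (ii) fails because
  -- the quotients have no finite limit.
  · have hnot : ¬ SGaS.SeriesConverges (SGaS.denTerm α m η) := fun h => h1 h.tendsto_zero
    refine ⟨iff_of_false ?_ fun h => hnot h.2, iff_of_false (h2 _) fun h => hnot h.2⟩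
    rintro ⟨N, D, -, hD, -⟩
    exact hnot ⟨D, hD⟩
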